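/- Let $n\ge 1$ and $m\ge 0$ be integers, let $\nu$ be Lebesgue measure on $\mathbb C^n$, $\langle z,w\rangle=\sum_j z_j\overline{w_j}$, and let $\mathcal H=L^2(\mathbb C^n,e^{-|z|^2}d\nu(z))$. Let $\widetilde\Delta$ be the magnetic Laplacian, i.e. the closure in $\mathcal H$ of the operator $$-\sum_{j=1}^n\frac{\partial^2}{\partial z_j\partial\bar z_j}+\sum_{j=1}^n\bar z_j\frac{\partial}{\partial\bar z_j}$$ with domain $C_0^\infty(\mathbb C^n)$. For $\varphi\in\mathcal H$ define the phase deformed magnetic Berezin transform $$\mathfrak B_m[\varphi](z)=\int_{\mathbb C^n}e^{\langle z,w\rangle}\,\frac{|K_m(z,w)|^2}{K_m(z,z)K_m(w,w)}\,\varphi(w)\,e^{-|w|^2}d\nu(w),\qquad K_m(z,w)=\pi^{-n}e^{\langle z,w\rangle}L_m^{(n-1)}(|z-w|^2),$$ where $L_m^{(\alpha)}$ are the Laguerre polynomials. Let $F(a,b;c;x)$ be Gauss's hypergeometric function ${}_2F_1$, let $(n)_m=n(n+1)\cdots(n+m-1)$, and put $$\sigma_l^{n,m}=(-1)^l\sum_{i=0}^l\binom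 li\binom{n+m-1}{m-l+i}\binom{n+m-1}{m-i},$$ where binomial coefficients with a negative lower index are $0$. Then $\widetilde\Delta$ is self-adjoint; for $0\le l\le 2m$ the operator $F(-\widetilde\Delta,n+l;n;\tfrac12)$, given by the Borel functional calculus of $\widetilde\Delta$ applied to $\lambda\mapsto F(-\lambda,n+l;n;\tfrac12)$, is bounded and everywhere defined on $\mathcal H$; for every $\varphi\in\mathcal H$ the integral defining $\mathfrak B_m[\varphi](z)$ converges absolutely for every $z\in\mathbb C^n$; and, as operators on $\mathcal H$, $$\mathfrak B_m=\frac{2^{-n}\pi^n}{\Gamma(n)}\left(\frac{m!}{(n)_m}\right)^2\sum_{l=0}^{2m}2^{-l}\,\sigma_l^{n,m}\,\frac{\Gamma(n+l)}{l!}\,F\!\left(-\widetilde\Delta,n+l;n;\tfrac12\right).$$ -/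

import Mathlib

open MeasureTheory
open scoped ContDiff ENNReal ComplexConjugate

noncomputable section

/-! ### Spectral measures and Borel functions of an unbounded operator -/

/-- A projection-valued measure on the Borel sets of `ℝ` in a Hilbert space `H`: orthogonal
projections `E S`, with `E ℝ = 1`, countably additive in the strong operator topology.
(The values on non-measurable sets are irrelevant.) -/
structure ProjectionMeasure (H : Type*) [NormedAddCommGroup H] [InnerProductSpace ℂ H]
    [CompleteSpace H] where
  proj : Set ℝ → H →L[ℂ] H
  isStarProjection : ∀ S, MeasurableSet S → IsStarProjection (proj S)
  proj_univ : proj Set.univ = 1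
  hasSum_iUnion : ∀ S : ℕ → Set ℝ, (∀ i, MeasurableSet (S i)) →
    Pairwise (fun i j => Disjoint (S i) (S j)) →
    ∀ x : H, HasSum (fun i => proj (S i) x) (proj (⋃ i, S i) x)

namespace ProjectionMeasure

variable {H : Type*} [NormedAddCommGroup H] [InnerProductSpace ℂ H] [CompleteSpace H]

theorem proj_empty_apply (E : ProjectionMeasure H) (x : H) : E.proj ∅ x = 0 := by
  have h := (E.hasSum_iUnion (fun _ => ∅) (fun _ => MeasurableSet.empty)
    (fun _ _ _ => disjoint_bot_left) x).summable
  exact tendsto_nhds_unique tendsto_const_nhds h.tendsto_atTop_zero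

theorem inner_proj_self (E : ProjectionMeasure H) (x : H) {S : Set ℝ} (hS : MeasurableSet S) :
    inner ℂ x (E.proj S x) = ((‖E.proj S x‖ ^ 2 : ℝ) : ℂ) := by
  have hP := E.isStarProjection S hS
  have h1 : E.proj S (E.proj S x) = E.proj S x :=
    congrArg (fun T : H →L[ℂ] H => T x) hP.isIdempotentElem
  have h2 : inner ℂ (E.proj S x) (E.proj S x) = inner ℂ x (E.proj S (E.proj S x)) :=
    (ContinuousLinearMap.isSelfAdjoint_iff_isSymmetric.mp hP.isSelfAdjoint) x (E.proj S x)
  rw [h1] at h2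
  rw [← h2, inner_self_eq_norm_sq_to_K]
  norm_cast

theorem hasSum_norm_sq (E : ProjectionMeasure H) (x : H) (S : ℕ → Set ℝ)
    (hS : ∀ i, MeasurableSet (S i)) (hd : Pairwise (fun i j => Disjoint (S i) (S j))) :
    HasSum (fun i => ‖E.proj (S i) x‖ ^ 2) (‖E.proj (⋃ i, S i) x‖ ^ 2) := by
  have h := (innerSL ℂ x).hasSum (E.hasSum_iUnion S hS hd x)
  simp only [innerSL_apply_apply, E.inner_proj_self x (hS _),
    E.inner_proj_self x (MeasurableSet.iUnion hS)] at h
  exact Complex.hasSum_ofReal.mp h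

/-- The scalar spectral measure `S ↦ ⟨x, E(S) x⟩ = ‖E(S) x‖²` of a vector `x`. -/
def scalarMeasure (E : ProjectionMeasure H) (x : H) : Measure ℝ :=
  Measure.ofMeasurable (fun S _ => ENNReal.ofReal (‖E.proj S x‖ ^ 2))
    (by simp [E.proj_empty_apply x])
    (by
      intro S hS hd
      have h := E.hasSum_norm_sq x S hS hd
      rw [← h.tsum_eq, ENNReal.ofReal_tsum_of_nonneg (fun _ => by positivity) h.summable])

/-- `T = ∫ g dE`: the domain of `T` consists of the `x` with `∫ |g|² d⟨x, E x⟩ < ∞`, and on it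
`⟨x, T x⟩ = ∫ g d⟨x, E x⟩`. By polarization this determines the operator `T`. -/
def IsIntegral (E : ProjectionMeasure H) (g : ℝ → ℂ) (T : H →ₗ.[ℂ] H) : Prop :=
  (∀ x : H, x ∈ T.domain ↔ MemLp g 2 (E.scalarMeasure x)) ∧
    ∀ x : T.domain, inner ℂ (x : H) (T x) = ∫ t, g t ∂(E.scalarMeasure x)

end ProjectionMeasure

/-- The bounded operator `T` is the function `g(A)` of the self-adjoint operator `A`, in the sense
of the Borel functional calculus: `A = ∫ t dE(t)` and `T = ∫ g(t) dE(t)`, where `E` is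
the (unique) spectral measure of `A`. -/
def IsFunctionOf {H : Type*} [NormedAddCommGroup H] [InnerProductSpace ℂ H] [CompleteSpace H]
    (A : H →ₗ.[ℂ] H) (g : ℝ → ℂ) (T : H →L[ℂ] H) : Prop :=
  ∃ E : ProjectionMeasure H, E.IsIntegral (fun t => (t : ℂ)) A ∧
    E.IsIntegral g ((T : H →ₗ[ℂ] H).toPMap ⊤)

/-! ### The magnetic Laplacian -/

/-- `ℂⁿ` with its Hermitian norm. -/
abbrev Cn (n : ℕ) : Type := EuclideanSpace ℂ (Fin n)

/-- The Gaussian measure `e^{-|z|²} dν(z)`, where `ν` is Lebesgue measure on `ℂⁿ`. -/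
def gaussMeasure (n : ℕ) : Measure (Cn n) :=
  (volume : Measure (Cn n)).withDensity (fun z => ENNReal.ofReal (Real.exp (-‖z‖ ^ 2)))

/-- The Hilbert space `L²(ℂⁿ, e^{-|z|²} dν(z))`. -/
abbrev GaussL2 (n : ℕ) : Type := Lp ℂ 2 (gaussMeasure n)

/-- `∂f/∂z_j = (∂f/∂x_j - i ∂f/∂y_j) / 2`. -/
def dz {n : ℕ} (j : Fin n) (f : Cn n → ℂ) (z : Cn n) : ℂ :=
  (fderiv ℝ f z (EuclideanSpace.single j 1)
    - Complex.I * fderiv ℝ f z (EuclideanSpace.single j Complex.I)) / 2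

/-- `∂f/∂z̄_j = (∂f/∂x_j + i ∂f/∂y_j) / 2`. -/
def dzbar {n : ℕ} (j : Fin n) (f : Cn n → ℂ) (z : Cn n) : ℂ :=
  (fderiv ℝ f z (EuclideanSpace.single j 1)
    + Complex.I * fderiv ℝ f z (EuclideanSpace.single j Complex.I)) / 2

/-- The differential expression `- ∑ ∂²f/∂z_j∂z̄_j + ∑ z̄_j ∂f/∂z̄_j`. -/
def magneticExpr {n : ℕ} (f : Cn n → ℂ) (z : Cn n) : ℂ :=
  -(∑ j, dz j (dzbar j f) z) + ∑ j, conj (z j) * dzbar j f z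

/-- `C₀^∞(ℂⁿ)`: complex-valued functions, smooth in the real sense, with compact support. -/
def testFunctions (n : ℕ) : Submodule ℂ (Cn n → ℂ) where
  carrier := {f | ContDiff ℝ ∞ f ∧ HasCompactSupport f}
  zero_mem' := ⟨contDiff_const, HasCompactSupport.zero⟩
  add_mem' := fun hf hg => ⟨hf.1.add hg.1, hf.2.add hg.2⟩
  smul_mem' := fun c _ hf => ⟨contDiff_const.smul hf.1, hf.2.smul_left (f := fun _ => c)⟩

section helpers

variable {n : ℕ}

theorem fderiv_apply_mem {f : Cn n → ℂ} (hf : f ∈ testFunctions n) (v : Cn n) :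
    (fun z => fderiv ℝ f z v) ∈ testFunctions n :=
  ⟨(hf.1.fderiv_right (m := ∞) (by simp)).clm_apply contDiff_const, hf.2.fderiv_apply ℝ v⟩

theorem dz_mem {f : Cn n → ℂ} (hf : f ∈ testFunctions n) (j : Fin n) :
    dz j f ∈ testFunctions n := by
  have h := (testFunctions n).smul_mem (1 / 2 : ℂ) ((testFunctions n).sub_mem
    (fderiv_apply_mem hf (EuclideanSpace.single j 1))
    ((testFunctions n).smul_mem Complex.I
      (fderiv_apply_mem hf (EuclideanSpace.single j Complex.I))))
  convert h using 1
  ext z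
  simp [dz]
  ring

theorem dzbar_mem {f : Cn n → ℂ} (hf : f ∈ testFunctions n) (j : Fin n) :
    dzbar j f ∈ testFunctions n := by
  have h := (testFunctions n).smul_mem (1 / 2 : ℂ) ((testFunctions n).add_mem
    (fderiv_apply_mem hf (EuclideanSpace.single j 1))
    ((testFunctions n).smul_mem Complex.I
      (fderiv_apply_mem hf (EuclideanSpace.single j Complex.I))))
  convert h using 1
  ext z
  simp [dzbar]
  ring

theorem conj_mul_mem {f : Cn n → ℂ} (hf : f ∈ testFunctions n) (j : Fin n) :
    (fun z : Cn n => conj (z j) * f z) ∈ testFunctions n := by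
  refine ⟨ContDiff.mul ?_ hf.1, hf.2.mul_left⟩
  have h : (fun z : Cn n => conj (z j)) =
      (Complex.conjCLE.toContinuousLinearMap.comp
        ((EuclideanSpace.proj j : Cn n →L[ℂ] ℂ).restrictScalars ℝ) : Cn n → ℂ) := by
    ext z; simp
  rw [h]
  exact ContinuousLinearMap.contDiff _

theorem magneticExpr_mem {f : Cn n → ℂ} (hf : f ∈ testFunctions n) :
    magneticExpr f ∈ testFunctions n := by
  have h := (testFunctions n).add_mem
    ((testFunctions n).neg_mem
      ((testFunctions n).sum_mem (t := Finset.univ) (f := fun j => dz j (dzbar j f))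
        (fun j _ => dz_mem (dzbar_mem hf j) j)))
    ((testFunctions n).sum_mem (t := Finset.univ)
      (f := fun j => fun z : Cn n => conj (z j) * dzbar j f z)
      (fun j _ => conj_mul_mem (dzbar_mem hf j) j))
  convert h using 1
  ext z
  simp [magneticExpr]

theorem testFunctions_differentiable {f : Cn n → ℂ} (hf : f ∈ testFunctions n) (z : Cn n) :
    DifferentiableAt ℝ f z := hf.1.differentiable (by simp) z

theorem dz_add {f g : Cn n → ℂ} (hf : f ∈ testFunctions n) (hg : g ∈ testFunctions n)
    (j : Fin n) : dz j (f + g) = dz j f + dz j g := by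
  ext z
  simp only [dz, Pi.add_apply, fderiv_add (testFunctions_differentiable hf z)
    (testFunctions_differentiable hg z), add_apply]
  ring

theorem dzbar_add {f g : Cn n → ℂ} (hf : f ∈ testFunctions n) (hg : g ∈ testFunctions n)
    (j : Fin n) : dzbar j (f + g) = dzbar j f + dzbar j g := by
  ext z
  simp only [dzbar, Pi.add_apply, fderiv_add (testFunctions_differentiable hf z)
    (testFunctions_differentiable hg z), add_apply]
  ring

theorem dz_smul {f : Cn n → ℂ} (hf : f ∈ testFunctions n) (c : ℂ) (j : Fin n) :
    dz j (c • f) = c • dz j f := by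
  ext z
  simp only [dz, fderiv_const_smul (testFunctions_differentiable hf z) c,
    smul_apply, Pi.smul_apply, smul_eq_mul]
  ring

theorem dzbar_smul {f : Cn n → ℂ} (hf : f ∈ testFunctions n) (c : ℂ) (j : Fin n) :
    dzbar j (c • f) = c • dzbar j f := by
  ext z
  simp only [dzbar, fderiv_const_smul (testFunctions_differentiable hf z) c,
    smul_apply, Pi.smul_apply, smul_eq_mul]
  ring

instance gaussMeasure_isFiniteMeasureOnCompacts : IsFiniteMeasureOnCompacts (gaussMeasure n) := by
  refine ⟨fun K hK => lt_of_le_of_lt ?_ (hK.measure_lt_top (μ := (volume : Measure (Cn n))))⟩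
  rw [gaussMeasure, withDensity_apply' _ K]
  calc ∫⁻ z in K, ENNReal.ofReal (Real.exp (-‖z‖ ^ 2)) ≤ ∫⁻ _ in K, 1 := by
        refine lintegral_mono fun z => ?_
        rw [ENNReal.ofReal_le_one, Real.exp_le_one_iff]
        simp
    _ = volume K := by simp

instance gaussMeasure_isOpenPosMeasure : (gaussMeasure n).IsOpenPosMeasure := by
  have h : (volume : Measure (Cn n)) ≪ gaussMeasure n := by
    refine withDensity_absolutelyContinuous' ?_ ?_
    · exact (by fun_prop : Measurable fun z : Cn n =>
        ENNReal.ofReal (Real.exp (-‖z‖ ^ 2))).aemeasurable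
    · filter_upwards with z
      simp [Real.exp_pos]
  exact h.isOpenPosMeasure

theorem testFunctions_memLp {f : Cn n → ℂ} (hf : f ∈ testFunctions n) :
    MemLp f 2 (gaussMeasure n) :=
  hf.1.continuous.memLp_of_hasCompactSupport hf.2

end helpers

/-- The class in `L²(ℂⁿ, e^{-|z|²} dν)` of a test function. -/
def testToL2 (n : ℕ) : testFunctions n →ₗ[ℂ] GaussL2 n where
  toFun f := (testFunctions_memLp f.2).toLp
  map_add' f g := MemLp.toLp_add (testFunctions_memLp f.2) (testFunctions_memLp g.2)
  map_smul' c f := MemLp.toLp_const_smul c (testFunctions_memLp f.2)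

theorem testToL2_injective (n : ℕ) : Function.Injective (testToL2 n) := by
  intro f g h
  have h' := (MemLp.toLp_eq_toLp_iff (testFunctions_memLp f.2) (testFunctions_memLp g.2)).mp h
  exact Subtype.ext ((f.2.1.continuous.ae_eq_iff_eq _ g.2.1.continuous).mp h')

/-- The magnetic Laplacian as a linear map of `C₀^∞(ℂⁿ)`. -/
def magneticTest (n : ℕ) : testFunctions n →ₗ[ℂ] testFunctions n where
  toFun f := ⟨magneticExpr (f : Cn n → ℂ), magneticExpr_mem f.2⟩
  map_add' f g := by
    ext z
    simp only [magneticExpr, Submodule.coe_add, dzbar_add f.2 g.2, Pi.add_apply,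
      dz_add (dzbar_mem f.2 _) (dzbar_mem g.2 _), mul_add, Finset.sum_add_distrib]
    ring
  map_smul' c f := by
    ext z
    simp only [magneticExpr, Submodule.coe_smul, dzbar_smul f.2, Pi.smul_apply,
      dz_smul (dzbar_mem f.2 _), smul_eq_mul, RingHom.id_apply, mul_left_comm _ c,
      ← Finset.mul_sum]
    ring

/-- The magnetic Laplacian `Δ̃` in `L²(ℂⁿ, e^{-|z|²} dν)` with domain `C₀^∞(ℂⁿ)`. -/
def magneticLaplacian₀ (n : ℕ) : GaussL2 n →ₗ.[ℂ] GaussL2 n where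
  domain := LinearMap.range (testToL2 n)
  toFun := testToL2 n ∘ₗ magneticTest n ∘ₗ
    (LinearEquiv.ofInjective (testToL2 n) (testToL2_injective n)).symm.toLinearMap

/-- The magnetic Laplacian `Δ̃` as a closed operator: the closure of `Δ̃` on `C₀^∞(ℂⁿ)`. -/
def magneticLaplacian (n : ℕ) : GaussL2 n →ₗ.[ℂ] GaussL2 n := (magneticLaplacian₀ n).closure

/-! ### The phase deformed magnetic Berezin transform -/

/-- The Laguerre polynomial `L_k^{(α)}(x) = ∑_j (-1)^j C(k+α, k-j) x^j / j!`, `α ∈ ℕ`. -/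
def laguerreL (k α : ℕ) (x : ℝ) : ℝ :=
  ∑ j ∈ Finset.range (k + 1),
    (-1) ^ j * ((k + α).choose (k - j) : ℝ) * x ^ j / (j.factorial : ℝ)

/-- The reproducing kernel `K_m(z, w) = π^{-n} e^{⟨z, w⟩} L_m^{(n-1)}(|z - w|²)`, `n ≥ 1`, where
`⟨z, w⟩ = ∑ z_j w̄_j`, which is `inner ℂ w z` in Mathlib's convention. -/
def reproKernel (n m : ℕ) (z w : Cn n) : ℂ :=
  (1 / (Real.pi : ℂ) ^ n) * Complex.exp (inner ℂ w z) * (laguerreL m (n - 1) (‖z - w‖ ^ 2) : ℂ)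

/-- The integrand of the phase deformed magnetic Berezin transform. -/
def berezinIntegrand (n m : ℕ) (φ : Cn n → ℂ) (z w : Cn n) : ℂ :=
  Complex.exp (inner ℂ w z) *
    ((‖reproKernel n m z w‖ ^ 2 : ℝ) / (reproKernel n m z z * reproKernel n m w w)) *
      φ w * (Real.exp (-‖w‖ ^ 2) : ℂ)

/-- The phase deformed magnetic Berezin transform
`𝔅_m[φ](z) = ∫ e^{⟨z,w⟩} |K_m(z,w)|² / (K_m(z,z) K_m(w,w)) φ(w) e^{-|w|²} dν(w)`. -/
def phaseBerezin (n m : ℕ) (φ : Cn n → ℂ) (z : Cn n) : ℂ :=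
  ∫ w, berezinIntegrand n m φ z w

/-! ### The coefficients -/

/-- The binomial coefficient `C(a, b)` for an integer `b`, zero for `b < 0`. -/
def binom (a : ℕ) (b : ℤ) : ℝ := if 0 ≤ b then (a.choose b.toNat : ℝ) else 0

/-- `σ_l^{n,m} = (-1)^l ∑_{i=0}^l C(l,i) C(n+m-1, m-l+i) C(n+m-1, m-i)`, `n ≥ 1`. -/
def sigmaCoeff (n m l : ℕ) : ℝ :=
  (-1) ^ l * ∑ i ∈ Finset.range (l + 1),
    (l.choose i : ℝ) * binom (n + m - 1) ((m : ℤ) - l + i) * binom (n + m - 1) ((m : ℤ) - i)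

/-- The Pochhammer symbol `(n)_m = n (n+1) ⋯ (n+m-1)`. -/
def poch (n m : ℕ) : ℝ := (ascPochhammer ℝ m).eval (n : ℝ)

end

/-!
The magnetic Laplacian is `∑ D_j* D_j`, where `D_j = ∂/∂z̄_j` and `D_j* = -∂/∂z_j + z̄_j` is the
adjoint of `D_j` in `L²(e^{-|z|²} dν)`. Hence it is symmetric on test functions, and a direct
computation shows that the functions `e^{p·z} (s·(z̄ - p))^k` (`landau p s k`) are eigenfunctions for
the eigenvalue `k ∈ ℕ`. They lie in the domain of the closure because cutoffs approximate them in
the graph norm (`exists_test_tendsto_landau`), and they are total: summing over `k` produces all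
exponentials `e^{p·z + s·z̄}`, in particular all characters, so a function orthogonal to them has
vanishing Fourier transform (`eq_zero_of_inner_landau`). A closed symmetric operator with a total
set of eigenvectors is self-adjoint and equals `∑ k P_k`, with `P_k` the projection onto the
`k`-th eigenspace; its Borel functions are the diagonal operators `∑ g(k) P_k`
(`isSelfAdjoint_of_eigen`, `isFunctionOf_diag`).

Since `|K_m(z,w)|²` contains the factor `e^{2 Re⟨z,w⟩} = e^{|z|² + |w|² - |z-w|²}`, and
`L_m^{(n-1)}(x)² = ∑ σ_l x^l / l!`, the kernel of the Berezin transform is a combination of the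
kernels `e^{⟨z,w⟩} |z-w|^{2l} e^{-|z-w|²}` (`berezinIntegrand_eq`). Substituting `w = z + u`
and completing the square, such a kernel maps an eigenfunction of level `k` to a multiple of itself;
the factor is a Gaussian moment. Integration by parts in `z` and `z̄` gives recursions in `k` and `l`
for these moments, solved by `(π/2)^n 2^{-l} ∑_j C(k,j) (-1/2)^j (n+j)_l` (`moment_eq`), which is
`(π/2)^n 2^{-l} (n)_l F(-k, n+l; n; 1/2)` (`poch_mul_hypergeometric`). The recursion also shows that
these numbers are `O(k^l 2^{-k})`, so they are bounded in `k`. The identity of operators then extends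
from the span of the eigenfunctions to the whole space by density: for fixed `z` the integral is a
continuous functional of `φ`, because its kernel is in `L²` (`radialOp_ae_eq`).
-/

noncomputable section

/-! ### Diagonal operators over a Hilbert sum of subspaces -/

section Diagonal

variable {H : Type*} [NormedAddCommGroup H] [InnerProductSpace ℂ H] [CompleteSpace H]

/-- A sequence of mutually orthogonal closed subspaces of `H` with dense linear span. -/
structure HilbertDecomposition (H : Type*) [NormedAddCommGroup H] [InnerProductSpace ℂ H]
    [CompleteSpace H] where
  space : ℕ → Submodule ℂ H
  isClosed_space : ∀ k, IsClosed (space k : Set H)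
  inner_eq_zero : ∀ j k, j ≠ k → ∀ x ∈ space j, ∀ y ∈ space k, inner ℂ x y = 0
  dense : (⨆ k, space k).topologicalClosure = ⊤

namespace HilbertDecomposition

variable (V : HilbertDecomposition H)

instance (k : ℕ) : CompleteSpace (V.space k) := (V.isClosed_space k).completeSpace_coe

/-- The orthogonal projection onto the `k`-th subspace. -/
def P (k : ℕ) : H →L[ℂ] H := (V.space k).starProjection

theorem P_mem (k : ℕ) (x : H) : V.P k x ∈ V.space k := Submodule.starProjection_apply_mem _ _

theorem P_of_mem {k : ℕ} {x : H} (hx : x ∈ V.space k) : V.P k x = x :=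
  Submodule.starProjection_eq_self_iff.mpr hx

theorem inner_P (k : ℕ) (x y : H) : inner ℂ (V.P k x) y = inner ℂ x (V.P k y) :=
  Submodule.inner_starProjection_left_eq_right _ x y

theorem P_of_mem_ne {j k : ℕ} (h : j ≠ k) {x : H} (hx : x ∈ V.space j) : V.P k x = 0 := by
  rw [P, Submodule.starProjection_apply_eq_zero_iff, Submodule.mem_orthogonal']
  exact fun u hu => V.inner_eq_zero j k h x hx u hu

theorem orthogonalFamily :
    OrthogonalFamily ℂ (fun k => V.space k) fun k => (V.space k).subtypeₗᵢ := by
  intro j k h x y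
  exact V.inner_eq_zero j k h x x.2 y y.2

/-- The components of an orthogonal series are its terms. -/
theorem P_tsum {y : ℕ → H} (hy : ∀ k, y k ∈ V.space k) {x : H} (h : HasSum y x) (j : ℕ) :
    V.P j x = y j := by
  have h1 := (V.P j).hasSum h
  have h2 : HasSum (fun k => V.P j (y k)) (V.P j (y j)) :=
    hasSum_single j fun k hk => V.P_of_mem_ne hk (hy k)
  rw [h1.unique h2, V.P_of_mem (hy j)]

theorem hasSum_P (x : H) : HasSum (fun k => V.P k x) x := by
  have hI := IsHilbertSum.mkInternal V.space V.orthogonalFamily V.dense.ge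
  have h := hI.hasSum_linearIsometryEquiv_symm (hI.linearIsometryEquiv x)
  rw [LinearIsometryEquiv.symm_apply_apply] at h
  convert h using 2 with k
  exact V.P_tsum (fun k => Submodule.coe_mem _) h k

theorem ext_P {x y : H} (h : ∀ k, V.P k x = V.P k y) : x = y := by
  have h1 := V.hasSum_P x
  simp only [h] at h1
  exact h1.unique (V.hasSum_P y)

theorem hasSum_inner_P (x y : H) :
    HasSum (fun k => inner ℂ (V.P k x) (V.P k y)) (inner ℂ x y) := by
  have h := (innerSL ℂ x).hasSum (V.hasSum_P y)
  simp only [innerSL_apply_apply] at h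
  simpa only [V.inner_P, V.P_of_mem (V.P_mem _ y)] using h

theorem hasSum_norm_sq_P (x : H) : HasSum (fun k => ‖V.P k x‖ ^ 2) (‖x‖ ^ 2) := by
  have h := V.hasSum_inner_P x x
  simp only [inner_self_eq_norm_sq_to_K] at h
  exact_mod_cast h

theorem summable_iff {y : ℕ → H} (hy : ∀ k, y k ∈ V.space k) :
    Summable y ↔ Summable fun k => ‖y k‖ ^ 2 :=
  V.orthogonalFamily.summable_iff_norm_sq_summable fun k => (⟨y k, hy k⟩ : V.space k)

theorem summable_smul_P_of_bounded {a : ℕ → ℂ} {C : ℝ} (ha : ∀ k, ‖a k‖ ≤ C) (x : H) :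
    Summable fun k => ‖a k • V.P k x‖ ^ 2 := by
  refine Summable.of_nonneg_of_le (fun k => by positivity) (fun k => ?_)
    ((V.hasSum_norm_sq_P x).summable.mul_left (C ^ 2))
  rw [norm_smul, mul_pow]
  gcongr
  exact ha k

/-- The bounded operator `∑ a_k P_k`, for a bounded sequence `a`. -/
def diag (a : ℕ → ℂ) (C : ℝ) (ha : ∀ k, ‖a k‖ ≤ C) : H →L[ℂ] H :=
  have hs (x : H) : Summable fun k => a k • V.P k x :=
    (V.summable_iff fun k => (V.space k).smul_mem _ (V.P_mem k x)).mpr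
      (V.summable_smul_P_of_bounded ha x)
  LinearMap.mkContinuous
    { toFun := fun x => ∑' k, a k • V.P k x
      map_add' := fun x y => by
        simp only [map_add, smul_add]
        exact (hs x).tsum_add (hs y)
      map_smul' := fun c x => by
        simp only [map_smul, smul_comm _ c, RingHom.id_apply]
        exact (hs x).tsum_const_smul c } C
    (fun x => by
      have hC : 0 ≤ C := (norm_nonneg _).trans (ha 0)
      refine le_of_sq_le_sq ?_ (by positivity)
      have h1 := V.hasSum_norm_sq_P (∑' k, a k • V.P k x)
      simp only [V.P_tsum (fun k => (V.space k).smul_mem _ (V.P_mem k x)) (hs x).hasSum] at h1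
      rw [mul_pow]
      refine hasSum_le (fun k => ?_) h1 ((V.hasSum_norm_sq_P x).mul_left (C ^ 2))
      rw [norm_smul, mul_pow]
      gcongr
      exact ha k)

theorem P_diag {a : ℕ → ℂ} {C : ℝ} (ha : ∀ k, ‖a k‖ ≤ C) (x : H) (k : ℕ) :
    V.P k (V.diag a C ha x) = a k • V.P k x := by
  have hm : ∀ k, a k • V.P k x ∈ V.space k := fun k => (V.space k).smul_mem _ (V.P_mem k x)
  exact V.P_tsum hm
    ((V.summable_iff hm).mpr (V.summable_smul_P_of_bounded ha x)).hasSum k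

theorem diag_of_mem {a : ℕ → ℂ} {C : ℝ} (ha : ∀ k, ‖a k‖ ≤ C) {x : H} {k : ℕ}
    (hx : x ∈ V.space k) : V.diag a C ha x = a k • x := by
  refine V.ext_P fun j => ?_
  rw [V.P_diag, map_smul]
  rcases eq_or_ne k j with rfl | h
  · rfl
  · rw [V.P_of_mem_ne h hx, smul_zero, smul_zero]

theorem norm_indicator_one_le (S : Set ℝ) (k : ℕ) :
    ‖S.indicator (1 : ℝ → ℂ) (k : ℝ)‖ ≤ 1 := by
  by_cases h : (k : ℝ) ∈ S <;> simp [h]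

/-- The projection-valued measure concentrated on `ℕ` with `E {k} = P_k`. -/
def projectionMeasure : ProjectionMeasure H where
  proj S := V.diag (fun k => S.indicator 1 (k : ℝ)) 1 (norm_indicator_one_le S)
  isStarProjection S _ := by
    rw [ContinuousLinearMap.isStarProjection_iff_isSymmetricProjection]
    constructor
    · ext x
      refine V.ext_P fun k => ?_
      simp only [Module.End.mul_apply, ContinuousLinearMap.coe_coe, V.P_diag]
      by_cases h : (k : ℝ) ∈ S <;> simp [h]
    · intro x y
      simp only [ContinuousLinearMap.coe_coe]
      refine (V.hasSum_inner_P _ _).unique ?_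
      convert V.hasSum_inner_P x (V.diag _ 1 (norm_indicator_one_le S) y) using 2 with k
      simp only [V.P_diag]
      by_cases h : (k : ℝ) ∈ S <;> simp [h]
  proj_univ := by
    ext x
    refine V.ext_P fun k => ?_
    simp [V.P_diag]
  hasSum_iUnion S _ hd x := by
    set y : ℕ → H := fun i => V.diag (fun k => (S i).indicator 1 (k : ℝ)) 1
      (norm_indicator_one_le _) x with hy
    -- Each summand of `∑ P_k x` belongs to at most one `S i`; regroup the sum accordingly.
    have hm : ∀ k, (⋃ i, S i).indicator (1 : ℝ → ℂ) (k : ℝ) • V.P k x ∈ V.space k :=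
      fun k => (V.space k).smul_mem _ (V.P_mem k x)
    have hs := (V.summable_iff hm).mpr
      (V.summable_smul_P_of_bounded (norm_indicator_one_le _) x)
    have key : HasSum (fun q : ℕ × ℕ => (S q.1).indicator (1 : ℝ → ℂ) (q.2 : ℝ) • V.P q.2 x)
        (V.diag (fun k => (⋃ i, S i).indicator 1 (k : ℝ)) 1 (norm_indicator_one_le _) x) := by
      have hdis : ∀ {i j : ℕ} {t : ℝ}, t ∈ S i → t ∈ S j → i = j := by
        intro i j t hi hj
        by_contra hij
        exact Set.disjoint_left.mp (hd hij) hi hj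
      let A : Set (ℕ × ℕ) := {q | (q.2 : ℝ) ∈ S q.1}
      have hA : Function.support
          (fun q : ℕ × ℕ => (S q.1).indicator (1 : ℝ → ℂ) (q.2 : ℝ) • V.P q.2 x) ⊆ A := by
        intro q hq
        by_contra h
        exact hq (by simp [show (q.2 : ℝ) ∉ S q.1 from h])
      rw [← hasSum_subtype_iff_of_support_subset hA]
      let B : Set ℕ := {k | (k : ℝ) ∈ ⋃ i, S i}
      have hB : Function.support
          (fun k : ℕ => (⋃ i, S i).indicator (1 : ℝ → ℂ) (k : ℝ) • V.P k x) ⊆ B := by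
        intro k hk
        by_contra h
        refine hk ?_
        simp only
        rw [Set.indicator_of_notMem (show (k : ℝ) ∉ ⋃ i, S i from h), zero_smul]
      have h1 := (hasSum_subtype_iff_of_support_subset hB).mpr hs.hasSum
      let e : A ≃ B := Equiv.ofBijective
        (fun q => ⟨q.1.2, Set.mem_iUnion.mpr ⟨q.1.1, q.2⟩⟩) (by
          constructor
          · rintro ⟨⟨i, k⟩, h⟩ ⟨⟨j, l⟩, h'⟩ hh
            have hkl : k = l := congrArg Subtype.val hh
            subst hkl
            have hij : i = j := hdis h h'
            subst hij
            rfl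
          · rintro ⟨k, hk⟩
            obtain ⟨i, hi⟩ := Set.mem_iUnion.mp hk
            exact ⟨⟨(i, k), hi⟩, rfl⟩)
      rw [← e.hasSum_iff] at h1
      convert h1 using 1
      swap; · rfl
      ext ⟨⟨i, k⟩, hik⟩
      have h2 : (k : ℝ) ∈ S i := hik
      have h3 : (k : ℝ) ∈ ⋃ i, S i := Set.mem_iUnion.mpr ⟨i, hik⟩
      change (S i).indicator (1 : ℝ → ℂ) (k : ℝ) • V.P k x
        = (⋃ i, S i).indicator (1 : ℝ → ℂ) (k : ℝ) • V.P k x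
      rw [Set.indicator_of_mem h2, Set.indicator_of_mem h3]
    refine key.prod_fiberwise fun i => ?_
    exact ((V.summable_iff fun k => (V.space k).smul_mem _ (V.P_mem k x)).mpr
      (V.summable_smul_P_of_bounded (norm_indicator_one_le _) x)).hasSum

/-- The distribution `∑ ‖P_k x‖² δ_k` on `ℕ` of a vector `x`. -/
def weight (x : H) : Measure ℕ :=
  Measure.count.withDensity fun k => ((‖V.P k x‖₊ ^ 2 : NNReal) : ℝ≥0∞)

theorem measurableEmbedding_natCast : MeasurableEmbedding (Nat.cast : ℕ → ℝ) where
  injective := Nat.cast_injective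
  measurable := measurable_from_top
  measurableSet_image' s _ := (s.to_countable.image _).measurableSet

theorem scalarMeasure_eq (x : H) :
    V.projectionMeasure.scalarMeasure x = (V.weight x).map (Nat.cast : ℕ → ℝ) := by
  ext S hS
  rw [ProjectionMeasure.scalarMeasure, Measure.ofMeasurable_apply _ hS,
    Measure.map_apply measurable_from_top hS, weight,
    withDensity_apply _ (measurable_from_top hS), ← lintegral_indicator (measurable_from_top hS),
    lintegral_count]
  have h := V.hasSum_norm_sq_P (V.projectionMeasure.proj S x)
  rw [← h.tsum_eq, ENNReal.ofReal_tsum_of_nonneg (fun _ => by positivity) h.summable]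
  congr 1
  ext k
  simp only [projectionMeasure, V.P_diag]
  by_cases hk : (k : ℝ) ∈ S
  · simp [hk, ENNReal.ofReal_pow, enorm_eq_nnnorm]
  · simp [hk]

theorem integrable_weight_iff (x : H) {F : Type*} [NormedAddCommGroup F]
    [NormedSpace ℝ F] (g : ℕ → F) :
    Integrable g (V.weight x) ↔ Summable fun k => ‖V.P k x‖ ^ 2 * ‖g k‖ := by
  rw [weight, integrable_withDensity_iff_integrable_smul measurable_from_top,
    integrable_count_iff, ← summable_norm_iff]
  refine summable_congr fun k => ?_
  rw [NNReal.smul_def, norm_smul]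
  simp

theorem integral_weight (x : H) {g : ℕ → ℂ} (hg : Integrable g (V.weight x)) :
    HasSum (fun k => ((‖V.P k x‖ ^ 2 : ℝ) : ℂ) * g k) (∫ k, g k ∂V.weight x) := by
  rw [weight, integrable_withDensity_iff_integrable_smul measurable_from_top] at hg
  rw [weight, integral_withDensity_eq_integral_smul measurable_from_top,
    integral_countable hg]
  have h := (integrable_count_iff.mp hg).of_norm.hasSum
  have h1 : ∀ k, ‖V.P k x‖₊ ^ 2 • g k = ((‖V.P k x‖ ^ 2 : ℝ) : ℂ) * g k := fun k => by
    rw [NNReal.smul_def]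
    simp
  simp only [count_real_singleton, one_smul, h1] at h ⊢
  exact h

/-- Criterion for `T = ∫ g dE` in terms of the components `P_k`. -/
theorem isIntegral_of_P {g : ℝ → ℂ} {T : H →ₗ.[ℂ] H}
    (hdom : ∀ x, x ∈ T.domain ↔ Summable fun k : ℕ => ‖g k • V.P k x‖ ^ 2)
    (hT : ∀ (x : T.domain) (k : ℕ), V.P k (T x) = g k • V.P k x) :
    V.projectionMeasure.IsIntegral g T := by
  have hmem : ∀ x, MemLp g 2 (V.projectionMeasure.scalarMeasure x) ↔
      Summable fun k : ℕ => ‖g k • V.P k x‖ ^ 2 := by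
    intro x
    rw [V.scalarMeasure_eq, measurableEmbedding_natCast.memLp_map_measure_iff,
      memLp_two_iff_integrable_sq_norm (measurable_from_top.aestronglyMeasurable),
      V.integrable_weight_iff]
    refine summable_congr fun k => ?_
    simp only [Function.comp, norm_smul, mul_pow, norm_pow, norm_norm]
    ring
  refine ⟨fun x => (hdom x).trans (hmem x).symm, fun x => ?_⟩
  have hsum := (hdom x).mp x.2
  have hint : Integrable (fun k : ℕ => g k) (V.weight (x : H)) := by
    rw [V.integrable_weight_iff]
    -- `|g| ‖P x‖² ≤ (|g|² + 1) ‖P x‖²`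
    refine Summable.of_nonneg_of_le (fun k => by positivity) (fun k => ?_)
      (hsum.add (V.hasSum_norm_sq_P x).summable)
    rw [norm_smul, mul_pow]
    nlinarith [sq_nonneg (‖g k‖ - 1), sq_nonneg (‖V.P k (x : H)‖), norm_nonneg (g k),
      mul_nonneg (sq_nonneg (‖V.P k (x : H)‖)) (sq_nonneg (‖g k‖ - 1))]
  rw [V.scalarMeasure_eq, measurableEmbedding_natCast.integral_map]
  refine HasSum.unique ?_ (V.integral_weight x hint)
  convert V.hasSum_inner_P (x : H) (T x) using 2 with k
  rw [hT, inner_smul_right, inner_self_eq_norm_sq_to_K, mul_comm]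
  norm_cast

theorem isIntegral_diag {g : ℝ → ℂ} {C : ℝ} (hg : ∀ k : ℕ, ‖g k‖ ≤ C) :
    V.projectionMeasure.IsIntegral g
      (((V.diag (fun k => g k) C hg : H →L[ℂ] H) : H →ₗ[ℂ] H).toPMap ⊤) :=
  V.isIntegral_of_P (fun x => ⟨fun _ => V.summable_smul_P_of_bounded hg x, fun _ => trivial⟩)
    fun x k => V.P_diag hg x k

end HilbertDecomposition

/-- The eigenspace of a densely defined operator, as a submodule of the whole space. -/
def LinearPMap.eigen (A : H →ₗ.[ℂ] H) (c : ℂ) : Submodule ℂ H :=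
  A.graph.comap (LinearMap.prod LinearMap.id (c • LinearMap.id))

theorem LinearPMap.mem_eigen {H : Type*} [NormedAddCommGroup H]
    [InnerProductSpace ℂ H] {A : H →ₗ.[ℂ] H} {c : ℂ} {x : H} :
    x ∈ A.eigen c ↔ (x, c • x) ∈ A.graph := Iff.rfl

/-- The eigenspaces of a closed symmetric operator for the eigenvalues `0, 1, 2, …`, when they span
a dense subspace. -/
def eigenDecomposition (A : H →ₗ.[ℂ] H) (hcl : A.IsClosed) (hsymm : A.IsFormalAdjoint A)
    (htot : (⨆ k : ℕ, A.eigen k).topologicalClosure = ⊤) : HilbertDecomposition H where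
  space k := A.eigen k
  isClosed_space k := by
    have : ((A.eigen (k : ℂ) : Submodule ℂ H) : Set H)
        = (fun x : H => (x, (k : ℂ) • x)) ⁻¹' (A.graph : Set (H × H)) := rfl
    rw [this]
    exact hcl.preimage (by fun_prop)
  inner_eq_zero j k hjk x hx y hy := by
    obtain ⟨x', hx', hAx⟩ := A.mem_graph_iff.mp (LinearPMap.mem_eigen.mp hx)
    obtain ⟨y', hy', hAy⟩ := A.mem_graph_iff.mp (LinearPMap.mem_eigen.mp hy)
    have h := hsymm x' y'
    simp only [hx', hy', hAx, hAy, inner_smul_left, inner_smul_right] at h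
    have h2 : ((j : ℂ) - k) * inner ℂ x y = 0 := by
      rw [sub_mul, sub_eq_zero]
      simpa using h
    rcases mul_eq_zero.mp h2 with h3 | h3
    · exact absurd (by exact_mod_cast sub_eq_zero.mp h3) hjk
    · exact h3
  dense := htot

section SelfAdjoint

variable {A : H →ₗ.[ℂ] H} (hcl : A.IsClosed) (hsymm : A.IsFormalAdjoint A)
  (htot : (⨆ k : ℕ, A.eigen k).topologicalClosure = ⊤)

/-- If `⟨y, A v⟩ = ⟨w, v⟩` for all `v`, then `w` has the components `k P_k y`. -/
theorem P_of_weak_eq {y w : H} (h : ∀ v : A.domain, inner ℂ w (v : H) = inner ℂ y (A v)) (k : ℕ) :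
    (eigenDecomposition A hcl hsymm htot).P k w
      = (k : ℂ) • (eigenDecomposition A hcl hsymm htot).P k y := by
  set V := eigenDecomposition A hcl hsymm htot
  refine ext_inner_right ℂ fun x => ?_
  rw [V.inner_P, inner_smul_left, V.inner_P]
  obtain ⟨v, hv, hAv⟩ := A.mem_graph_iff.mp (LinearPMap.mem_eigen.mp (V.P_mem k x))
  simp only at hv hAv
  rw [← hv, h v, hAv, inner_smul_right, hv]
  simp

/-- As the graph is closed, it contains every pair whose components lie in it. -/
theorem mem_graph_of_P {y w : H}
    (h : ∀ k : ℕ, (eigenDecomposition A hcl hsymm htot).P k w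
      = (k : ℂ) • (eigenDecomposition A hcl hsymm htot).P k y) : (y, w) ∈ A.graph := by
  set V := eigenDecomposition A hcl hsymm htot
  have h1 : HasSum (fun k => (V.P k y, V.P k w)) (y, w) :=
    (V.hasSum_P y).prodMk (V.hasSum_P w)
  refine hcl.mem_of_tendsto h1 (Filter.Eventually.of_forall fun s => ?_)
  refine Submodule.sum_mem _ fun k _ => ?_
  rw [h]
  exact LinearPMap.mem_eigen.mp (V.P_mem k y)

/-- A closed symmetric operator with a total set of eigenvectors is self-adjoint: an element of the
domain of the adjoint has its components in the graph of `A`. -/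
theorem isSelfAdjoint_of_eigen {A : H →ₗ.[ℂ] H} (hcl : A.IsClosed) (hsymm : A.IsFormalAdjoint A)
    (htot : (⨆ k : ℕ, A.eigen k).topologicalClosure = ⊤) : IsSelfAdjoint A := by
  set V := eigenDecomposition A hcl hsymm htot with hV
  have hdense : Dense (A.domain : Set H) := by
    rw [Submodule.dense_iff_topologicalClosure_eq_top, eq_top_iff, ← htot]
    refine Submodule.topologicalClosure_mono (iSup_le fun k x hx => ?_)
    exact LinearPMap.mem_domain_of_mem_graph (LinearPMap.mem_eigen.mp hx)
  rw [LinearPMap.isSelfAdjoint_def]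
  refine (LinearPMap.eq_of_le_of_domain_eq (hsymm.le_adjoint hdense) ?_).symm
  refine le_antisymm (hsymm.le_adjoint hdense).1 fun y hy => ?_
  have h := P_of_weak_eq hcl hsymm htot (y := y) (w := A.adjoint ⟨y, hy⟩)
    fun v => A.adjoint_isFormalAdjoint hdense ⟨y, hy⟩ v
  exact LinearPMap.mem_domain_of_mem_graph (mem_graph_of_P hcl hsymm htot h)

/-- The spectral theorem for a closed symmetric operator with eigenvalues `0, 1, 2, …`. -/
theorem isIntegral_id :
    (eigenDecomposition A hcl hsymm htot).projectionMeasure.IsIntegral (fun t => (t : ℂ)) A := by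
  set V := eigenDecomposition A hcl hsymm htot with hV
  have hP : ∀ (x : A.domain) (k : ℕ), V.P k (A x) = (k : ℂ) • V.P k (x : H) :=
    fun x k => P_of_weak_eq hcl hsymm htot (fun v => hsymm x v) k
  refine V.isIntegral_of_P (fun x => ?_) (fun x k => by simpa using hP x k)
  simp only [Complex.ofReal_natCast]
  constructor
  · intro hx
    simpa only [hP ⟨x, hx⟩] using (V.hasSum_norm_sq_P (A ⟨x, hx⟩)).summable
  · intro hs
    have hm : ∀ k : ℕ, (k : ℂ) • V.P k x ∈ V.space k :=
      fun k => (V.space k).smul_mem _ (V.P_mem k x)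
    have h := ((V.summable_iff hm).mpr hs).hasSum
    exact LinearPMap.mem_domain_of_mem_graph
      (mem_graph_of_P hcl hsymm htot (w := ∑' k : ℕ, (k : ℂ) • V.P k x) fun k => V.P_tsum hm h k)

/-- A function that is bounded on the eigenvalues defines a bounded operator. -/
theorem isFunctionOf_diag {g : ℝ → ℂ} {C : ℝ} (hg : ∀ k : ℕ, ‖g k‖ ≤ C) :
    IsFunctionOf A g ((eigenDecomposition A hcl hsymm htot).diag (fun k => g k) C hg) :=
  ⟨_, isIntegral_id hcl hsymm htot, HilbertDecomposition.isIntegral_diag _ hg⟩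

end SelfAdjoint

end Diagonal

/-! ### Wirtinger calculus -/

section Wirtinger

variable {n : ℕ}

theorem dz_mul {f g : Cn n → ℂ} {z : Cn n} (hf : DifferentiableAt ℝ f z)
    (hg : DifferentiableAt ℝ g z) (j : Fin n) :
    dz j (fun z => f z * g z) z = dz j f z * g z + f z * dz j g z := by
  simp only [dz, fderiv_fun_mul hf hg, add_apply, smul_apply, smul_eq_mul]
  ring

theorem dzbar_mul {f g : Cn n → ℂ} {z : Cn n} (hf : DifferentiableAt ℝ f z)
    (hg : DifferentiableAt ℝ g z) (j : Fin n) :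
    dzbar j (fun z => f z * g z) z = dzbar j f z * g z + f z * dzbar j g z := by
  simp only [dzbar, fderiv_fun_mul hf hg, add_apply, smul_apply, smul_eq_mul]
  ring

theorem dz_comp {h : ℂ → ℂ} {h' : ℂ} {f : Cn n → ℂ} {z : Cn n} (hh : HasDerivAt h h' (f z))
    (hf : DifferentiableAt ℝ f z) (j : Fin n) :
    dz j (fun z => h (f z)) z = h' * dz j f z := by
  have h1 := (hh.hasFDerivAt.restrictScalars ℝ).comp z hf.hasFDerivAt
  have h2 : fderiv ℝ (fun z => h (f z)) z = _ := h1.fderiv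
  simp only [dz, h2]
  simp
  ring

theorem dzbar_comp {h : ℂ → ℂ} {h' : ℂ} {f : Cn n → ℂ} {z : Cn n} (hh : HasDerivAt h h' (f z))
    (hf : DifferentiableAt ℝ f z) (j : Fin n) :
    dzbar j (fun z => h (f z)) z = h' * dzbar j f z := by
  have h1 := (hh.hasFDerivAt.restrictScalars ℝ).comp z hf.hasFDerivAt
  have h2 : fderiv ℝ (fun z => h (f z)) z = _ := h1.fderiv
  simp only [dzbar, h2]
  simp
  ring

theorem fderiv_conj_comp {f : Cn n → ℂ} {z : Cn n} (hf : DifferentiableAt ℝ f z) (v : Cn n) :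
    fderiv ℝ (fun z => conj (f z)) z v = conj (fderiv ℝ f z v) := by
  have h1 := (Complex.conjCLE.toContinuousLinearMap.hasFDerivAt (x := f z)).comp z hf.hasFDerivAt
  have h2 : fderiv ℝ (fun z => conj (f z)) z = _ := h1.fderiv
  rw [h2]
  simp

theorem dz_conj {f : Cn n → ℂ} {z : Cn n} (hf : DifferentiableAt ℝ f z) (j : Fin n) :
    dz j (fun z => conj (f z)) z = conj (dzbar j f z) := by
  simp only [dz, dzbar, fderiv_conj_comp hf, map_div₀, map_add, map_mul, Complex.conj_I,
    Complex.conj_ofNat]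
  ring

theorem dz_fun_add {f g : Cn n → ℂ} {z : Cn n} (hf : DifferentiableAt ℝ f z)
    (hg : DifferentiableAt ℝ g z) (j : Fin n) :
    dz j (fun z => f z + g z) z = dz j f z + dz j g z := by
  simp only [dz, fderiv_fun_add hf hg, add_apply]
  ring

theorem dzbar_fun_add {f g : Cn n → ℂ} {z : Cn n} (hf : DifferentiableAt ℝ f z)
    (hg : DifferentiableAt ℝ g z) (j : Fin n) :
    dzbar j (fun z => f z + g z) z = dzbar j f z + dzbar j g z := by
  simp only [dzbar, fderiv_fun_add hf hg, add_apply]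
  ring

theorem dz_const (c : ℂ) (j : Fin n) (z : Cn n) : dz j (fun _ => c) z = 0 := by
  simp [dz]

theorem dzbar_const (c : ℂ) (j : Fin n) (z : Cn n) : dzbar j (fun _ => c) z = 0 := by
  simp [dzbar]

/-- The complex-linear form `z ↦ ∑ p_j z_j`. -/
def dot (p : Fin n → ℂ) : Cn n →L[ℝ] ℂ :=
  ∑ j, p j • ((EuclideanSpace.proj j : Cn n →L[ℂ] ℂ).restrictScalars ℝ)

/-- The antilinear form `z ↦ ∑ s_j z̄_j`. -/
def cdot (s : Fin n → ℂ) : Cn n →L[ℝ] ℂ :=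
  ∑ j, s j • (Complex.conjCLE.toContinuousLinearMap.comp
    ((EuclideanSpace.proj j : Cn n →L[ℂ] ℂ).restrictScalars ℝ))

theorem dot_apply (p : Fin n → ℂ) (z : Cn n) : dot p z = ∑ j, p j * z j := by
  simp [dot]

theorem cdot_apply (s : Fin n → ℂ) (z : Cn n) : cdot s z = ∑ j, s j * conj (z j) := by
  simp [cdot]

theorem coord_eq_dot (j : Fin n) : (fun z : Cn n => z j) = dot (Pi.single j 1) := by
  ext z
  simp [dot_apply, Pi.single_apply]

theorem conj_coord_eq_cdot (j : Fin n) : (fun z : Cn n => conj (z j)) = cdot (Pi.single j 1) := by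
  ext z
  simp [cdot_apply, Pi.single_apply]

theorem dz_dot (p : Fin n → ℂ) (j : Fin n) (z : Cn n) : dz j (dot p) z = p j := by
  simp only [dz, (dot p).fderiv, dot_apply, PiLp.single_apply]
  simp
  linear_combination (-(p j) / 2) * Complex.I_sq

theorem dzbar_dot (p : Fin n → ℂ) (j : Fin n) (z : Cn n) : dzbar j (dot p) z = 0 := by
  simp only [dzbar, (dot p).fderiv, dot_apply, PiLp.single_apply]
  simp
  linear_combination (p j) * Complex.I_sq

theorem conj_ite_single (i j : Fin n) (c : ℂ) :
    conj (if i = j then c else 0 : ℂ) = if i = j then conj c else 0 := by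
  split_ifs <;> simp

theorem dz_cdot (p : Fin n → ℂ) (j : Fin n) (z : Cn n) : dz j (cdot p) z = 0 := by
  simp only [dz, (cdot p).fderiv, cdot_apply, PiLp.single_apply, conj_ite_single]
  simp
  linear_combination (p j) * Complex.I_sq

theorem dzbar_cdot (p : Fin n → ℂ) (j : Fin n) (z : Cn n) : dzbar j (cdot p) z = p j := by
  simp only [dzbar, (cdot p).fderiv, cdot_apply, PiLp.single_apply, conj_ite_single]
  simp
  linear_combination (-(p j) / 2) * Complex.I_sq

theorem ofReal_norm_sq (z : Cn n) : ((‖z‖ ^ 2 : ℝ) : ℂ) = ∑ j, z j * conj (z j) := by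
  rw [EuclideanSpace.norm_sq_eq, Complex.ofReal_sum]
  refine Finset.sum_congr rfl fun j _ => ?_
  rw [Complex.mul_conj, Complex.normSq_eq_norm_sq]

theorem contDiff_norm_sq_complex : ContDiff ℝ ∞ fun z : Cn n => ((‖z‖ ^ 2 : ℝ) : ℂ) :=
  Complex.ofRealCLM.contDiff.comp (contDiff_norm_sq ℝ)

theorem fderiv_ofReal_norm_sq (z v : Cn n) :
    fderiv ℝ (fun z : Cn n => ((‖z‖ ^ 2 : ℝ) : ℂ)) z v = ((2 * inner ℝ z v : ℝ) : ℂ) := by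
  have h1 := (Complex.ofRealCLM.hasFDerivAt (x := ‖z‖ ^ 2)).comp z
    (hasStrictFDerivAt_norm_sq z).hasFDerivAt
  have h2 : fderiv ℝ (fun z : Cn n => ((‖z‖ ^ 2 : ℝ) : ℂ)) z = _ := h1.fderiv
  rw [h2]
  simp

theorem dz_norm_sq (j : Fin n) (z : Cn n) :
    dz j (fun z : Cn n => ((‖z‖ ^ 2 : ℝ) : ℂ)) z = conj (z j) := by
  simp only [dz, fderiv_ofReal_norm_sq]
  apply Complex.ext <;> simp [PiLp.inner_apply, PiLp.single_apply, Complex.inner, apply_ite]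
  ring

theorem dzbar_norm_sq (j : Fin n) (z : Cn n) :
    dzbar j (fun z : Cn n => ((‖z‖ ^ 2 : ℝ) : ℂ)) z = z j := by
  simp only [dzbar, fderiv_ofReal_norm_sq]
  apply Complex.ext <;> simp [PiLp.inner_apply, PiLp.single_apply, Complex.inner, apply_ite]

/-- The Gaussian `e^{-τ|z|²}`, with complex values. -/
def gaussian (τ : ℝ) (z : Cn n) : ℂ := (Real.exp (-(τ * ‖z‖ ^ 2)) : ℂ)

theorem gaussian_eq_cexp (τ : ℝ) :
    gaussian (n := n) τ = fun z => Complex.exp (-τ * ((‖z‖ ^ 2 : ℝ) : ℂ)) := by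
  ext z
  simp [gaussian]

theorem contDiff_gaussian (τ : ℝ) : ContDiff ℝ ∞ (gaussian (n := n) τ) := by
  rw [gaussian_eq_cexp]
  exact (contDiff_const.mul contDiff_norm_sq_complex).cexp

theorem dz_gaussian (τ : ℝ) (j : Fin n) (z : Cn n) :
    dz j (gaussian τ) z = -τ * conj (z j) * gaussian τ z := by
  have hd : DifferentiableAt ℝ (fun z : Cn n => ((‖z‖ ^ 2 : ℝ) : ℂ)) z :=
    contDiff_norm_sq_complex.differentiable (by simp) z
  rw [gaussian_eq_cexp, dz_comp (Complex.hasDerivAt_exp _) (hd.const_mul _),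
    dz_mul (differentiableAt_const _) hd, dz_const, dz_norm_sq]
  ring

theorem dzbar_gaussian (τ : ℝ) (j : Fin n) (z : Cn n) :
    dzbar j (gaussian τ) z = -τ * z j * gaussian τ z := by
  have hd : DifferentiableAt ℝ (fun z : Cn n => ((‖z‖ ^ 2 : ℝ) : ℂ)) z :=
    contDiff_norm_sq_complex.differentiable (by simp) z
  rw [gaussian_eq_cexp, dzbar_comp (Complex.hasDerivAt_exp _) (hd.const_mul _),
    dzbar_mul (differentiableAt_const _) hd, dzbar_const, dzbar_norm_sq]
  ring

end Wirtinger

/-! ### Functions of exponential growth -/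

section Growth

variable {n : ℕ} {F : Type*} [NormedAddCommGroup F]

/-- Continuous functions with `‖f(z)‖ ≤ C e^{c|z|}` for some `C`, `c ≥ 0`. -/
def ExpGrowth (f : Cn n → F) : Prop :=
  Continuous f ∧ ∃ C c : ℝ, 0 ≤ C ∧ 0 ≤ c ∧ ∀ z, ‖f z‖ ≤ C * Real.exp (c * ‖z‖)

namespace ExpGrowth

theorem of_bounded {f : Cn n → F} (hf : Continuous f) {C : ℝ} (h : ∀ z, ‖f z‖ ≤ C) :
    ExpGrowth f :=
  ⟨hf, C, 0, (norm_nonneg _).trans (h 0), le_rfl, fun z => by simpa using h z⟩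

theorem const (c : F) : ExpGrowth (fun _ : Cn n => c) :=
  of_bounded continuous_const fun _ => le_rfl

theorem clm [NormedSpace ℝ F] (L : Cn n →L[ℝ] F) : ExpGrowth L := by
  refine ⟨L.continuous, ‖L‖, 1, norm_nonneg _, zero_le_one, fun z => (L.le_opNorm z).trans ?_⟩
  gcongr
  linarith [Real.add_one_le_exp (1 * ‖z‖)]

theorem add {f g : Cn n → F} (hf : ExpGrowth f) (hg : ExpGrowth g) :
    ExpGrowth fun z => f z + g z := by
  obtain ⟨h1, C, c, hC, hc, h2⟩ := hf
  obtain ⟨h1', C', c', hC', hc', h2'⟩ := hg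
  refine ⟨h1.add h1', C + C', c + c', by positivity, by positivity, fun z => ?_⟩
  refine (norm_add_le _ _).trans ((add_le_add (h2 z) (h2' z)).trans ?_)
  rw [add_mul]
  gcongr <;> linarith

theorem sum {ι : Type*} (s : Finset ι) {f : ι → Cn n → F} (hf : ∀ i ∈ s, ExpGrowth (f i)) :
    ExpGrowth fun z => ∑ i ∈ s, f i z := by
  classical
  induction s using Finset.induction_on with
  | empty => simpa using const (n := n) (0 : F)
  | insert i s hi ih =>
    simp only [Finset.sum_insert hi]
    exact (hf i (by simp)).add (ih fun j hj => hf j (by simp [hj]))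

/-- A continuous function dominated by a product of two functions of exponential growth. -/
theorem of_le_mul {F₁ F₂ : Type*} [NormedAddCommGroup F₁] [NormedAddCommGroup F₂]
    {f : Cn n → F} {g : Cn n → F₁} {h : Cn n → F₂} (hf : Continuous f) (hg : ExpGrowth g)
    (hh : ExpGrowth h) (hle : ∀ z, ‖f z‖ ≤ ‖g z‖ * ‖h z‖) : ExpGrowth f := by
  obtain ⟨-, C, c, hC, hc, h2⟩ := hg
  obtain ⟨-, C', c', hC', hc', h2'⟩ := hh
  refine ⟨hf, C * C', c + c', by positivity, by positivity, fun z => (hle z).trans ?_⟩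
  refine (mul_le_mul (h2 z) (h2' z) (norm_nonneg _) (by positivity)).trans_eq ?_
  rw [add_mul, Real.exp_add]
  ring

theorem smul {f : Cn n → ℂ} {F : Type*} [NormedAddCommGroup F] [NormedSpace ℂ F]
    {g : Cn n → F}
    (hf : ExpGrowth f) (hg : ExpGrowth g) : ExpGrowth fun z => f z • g z :=
  of_le_mul (hf.1.smul hg.1) hf hg fun _ => (norm_smul _ _).le

theorem mul {f g : Cn n → ℂ} (hf : ExpGrowth f) (hg : ExpGrowth g) :
    ExpGrowth fun z => f z * g z := hf.smul hg

theorem pow {f : Cn n → ℂ} (hf : ExpGrowth f) (k : ℕ) : ExpGrowth fun z => f z ^ k := by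
  induction k with
  | zero => simpa using const (n := n) (1 : ℂ)
  | succ k ih => simpa only [pow_succ] using ih.mul hf

theorem star {f : Cn n → ℂ} (hf : ExpGrowth f) : ExpGrowth fun z => conj (f z) := by
  obtain ⟨h, C, c, hC, hc, hb⟩ := hf
  exact ⟨Complex.continuous_conj.comp h, C, c, hC, hc, fun z => by simpa using hb z⟩

theorem cexp_clm (L : Cn n →L[ℝ] ℂ) : ExpGrowth fun z => Complex.exp (L z) := by
  refine ⟨by fun_prop, 1, ‖L‖, zero_le_one, norm_nonneg _, fun z => ?_⟩
  rw [Complex.norm_exp, one_mul, Real.exp_le_exp]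
  exact (Complex.re_le_norm _).trans (L.le_opNorm z)

theorem coord (j : Fin n) : ExpGrowth fun z : Cn n => z j := by
  rw [coord_eq_dot]
  exact clm _

theorem conj_coord (j : Fin n) : ExpGrowth fun z : Cn n => conj (z j) :=
  (coord j).star

theorem norm_sq : ExpGrowth fun z : Cn n => ((‖z‖ ^ 2 : ℝ) : ℂ) := by
  simp only [ofReal_norm_sq]
  exact sum _ fun j _ => (coord j).mul (conj_coord j)

theorem integrable_mul_gaussian {f : Cn n → ℂ} (hf : ExpGrowth f) {τ : ℝ} (hτ : 0 < τ) :
    Integrable fun z => f z * gaussian τ z := by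
  obtain ⟨h, C, c, hC, hc, hb⟩ := hf
  have h1 := (GaussianFourier.integrable_cexp_neg_mul_sq_norm_add (V := Cn n)
    (b := ((τ / 2 : ℝ) : ℂ)) (by simpa using hτ) 0 0).norm.const_mul
      (C * Real.exp (c ^ 2 / (2 * τ)))
  refine h1.mono' ((h.mul (contDiff_gaussian τ).continuous).aestronglyMeasurable)
    (Filter.Eventually.of_forall fun z => ?_)
  rw [norm_mul, gaussian, Complex.norm_real, Real.norm_of_nonneg (Real.exp_pos _).le,
    Complex.norm_exp]
  refine (mul_le_mul_of_nonneg_right (hb z) (Real.exp_pos _).le).trans ?_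
  rw [mul_assoc, mul_assoc, ← Real.exp_add, ← Real.exp_add]
  refine mul_le_mul_of_nonneg_left (Real.exp_le_exp.mpr ?_) hC
  have : c ^ 2 / (2 * τ) + (τ / 2) * ‖z‖ ^ 2 - c * ‖z‖ = (c - τ * ‖z‖) ^ 2 / (2 * τ) := by
    field_simp
    ring
  have h2 : 0 ≤ (c - τ * ‖z‖) ^ 2 / (2 * τ) := by positivity
  have h3 : (-((τ / 2 : ℝ) : ℂ) * (‖z‖ : ℂ) ^ 2 + 0 * ((inner ℝ (0 : Cn n) z : ℝ) : ℂ)).re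
      = -(τ / 2 * ‖z‖ ^ 2) := by
    rw [zero_mul, add_zero, ← Complex.ofReal_pow, ← Complex.ofReal_neg, ← Complex.ofReal_mul,
      Complex.ofReal_re]
    ring
  rw [h3]
  linarith

end ExpGrowth

theorem measurable_gaussDensity :
    Measurable fun z : Cn n => (Real.exp (-‖z‖ ^ 2)).toNNReal := by fun_prop

theorem gaussMeasure_eq :
    gaussMeasure n = (volume : Measure (Cn n)).withDensity
      fun z => ((Real.exp (-‖z‖ ^ 2)).toNNReal : ℝ≥0∞) := rfl

theorem toNNReal_smul_eq_mul_gaussian (f : Cn n → ℂ) (z : Cn n) :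
    (Real.exp (-‖z‖ ^ 2)).toNNReal • f z = f z * gaussian 1 z := by
  rw [NNReal.smul_def, Real.coe_toNNReal _ (Real.exp_pos _).le, gaussian, Complex.real_smul,
    one_mul, mul_comm]

theorem integrable_gaussMeasure_iff {f : Cn n → ℂ} :
    Integrable f (gaussMeasure n) ↔ Integrable fun z => f z * gaussian 1 z := by
  rw [gaussMeasure_eq, integrable_withDensity_iff_integrable_smul measurable_gaussDensity]
  simp only [toNNReal_smul_eq_mul_gaussian]

theorem integral_gaussMeasure (f : Cn n → ℂ) :
    ∫ z, f z ∂gaussMeasure n = ∫ z, f z * gaussian 1 z := by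
  rw [gaussMeasure_eq, integral_withDensity_eq_integral_smul measurable_gaussDensity]
  simp only [toNNReal_smul_eq_mul_gaussian]

theorem ExpGrowth.memLp {f : Cn n → ℂ} (hf : ExpGrowth f) : MemLp f 2 (gaussMeasure n) := by
  rw [memLp_two_iff_integrable_sq_norm hf.1.aestronglyMeasurable]
  suffices h : Integrable (fun z => ((‖f z‖ ^ 2 : ℝ) : ℂ)) (gaussMeasure n) by
    simpa only [RCLike.re_eq_complex_re, Complex.ofReal_re] using h.re
  rw [integrable_gaussMeasure_iff]
  refine ExpGrowth.integrable_mul_gaussian ?_ one_pos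
  convert hf.mul hf.star using 2 with z
  rw [Complex.mul_conj, Complex.normSq_eq_norm_sq]

/-- Continuously differentiable functions of exponential growth together with their
derivative. -/
def ExpGrowthC1 (f : Cn n → ℂ) : Prop :=
  Differentiable ℝ f ∧ ExpGrowth f ∧ ExpGrowth (fderiv ℝ f)

namespace ExpGrowthC1

theorem const (c : ℂ) : ExpGrowthC1 (fun _ : Cn n => c) :=
  ⟨differentiable_const c, .const c, by
    rw [fderiv_fun_const]
    exact ExpGrowth.const (n := n) (0 : Cn n →L[ℝ] ℂ)⟩

theorem clm (L : Cn n →L[ℝ] ℂ) : ExpGrowthC1 L :=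
  ⟨L.differentiable, .clm L, by
    rw [show fderiv ℝ L = fun _ => L from funext fun _ => L.fderiv]
    exact .const L⟩

theorem add {f g : Cn n → ℂ} (hf : ExpGrowthC1 f) (hg : ExpGrowthC1 g) :
    ExpGrowthC1 fun z => f z + g z := by
  refine ⟨hf.1.add hg.1, hf.2.1.add hg.2.1, ?_⟩
  have : fderiv ℝ (fun z => f z + g z) = fun z => fderiv ℝ f z + fderiv ℝ g z := by
    ext1 z
    exact fderiv_fun_add (hf.1 z) (hg.1 z)
  rw [this]
  exact hf.2.2.add hg.2.2

theorem mul {f g : Cn n → ℂ} (hf : ExpGrowthC1 f) (hg : ExpGrowthC1 g) :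
    ExpGrowthC1 fun z => f z * g z := by
  refine ⟨hf.1.mul hg.1, hf.2.1.mul hg.2.1, ?_⟩
  have : fderiv ℝ (fun z => f z * g z) = fun z => f z • fderiv ℝ g z + g z • fderiv ℝ f z := by
    ext1 z
    exact fderiv_fun_mul (hf.1 z) (hg.1 z)
  rw [this]
  exact (hf.2.1.smul hg.2.2).add (hg.2.1.smul hf.2.2)

theorem pow {f : Cn n → ℂ} (hf : ExpGrowthC1 f) (k : ℕ) : ExpGrowthC1 fun z => f z ^ k := by
  induction k with
  | zero => simpa using const (n := n) (1 : ℂ)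
  | succ k ih => simpa only [pow_succ] using ih.mul hf

theorem sum {ι : Type*} (s : Finset ι) {f : ι → Cn n → ℂ} (hf : ∀ i ∈ s, ExpGrowthC1 (f i)) :
    ExpGrowthC1 fun z => ∑ i ∈ s, f i z := by
  classical
  induction s using Finset.induction_on with
  | empty => simpa using const (n := n) (0 : ℂ)
  | insert i s hi ih =>
    simp only [Finset.sum_insert hi]
    exact (hf i (by simp)).add (ih fun j hj => hf j (by simp [hj]))

theorem coord (j : Fin n) : ExpGrowthC1 fun z : Cn n => z j := by
  rw [coord_eq_dot]
  exact clm _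

theorem conj_coord (j : Fin n) : ExpGrowthC1 fun z : Cn n => conj (z j) := by
  rw [conj_coord_eq_cdot]
  exact clm _

theorem norm_sq : ExpGrowthC1 fun z : Cn n => ((‖z‖ ^ 2 : ℝ) : ℂ) := by
  simp only [ofReal_norm_sq]
  exact sum _ fun j _ => (coord j).mul (conj_coord j)

theorem cexp_clm (L : Cn n →L[ℝ] ℂ) : ExpGrowthC1 fun z => Complex.exp (L z) := by
  have h : ∀ z, HasFDerivAt (fun z => Complex.exp (L z)) (Complex.exp (L z) • L) z :=
    fun z => L.hasFDerivAt.cexp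
  refine ⟨fun z => (h z).differentiableAt, .cexp_clm L, ?_⟩
  have : fderiv ℝ (fun z => Complex.exp (L z)) = fun z => Complex.exp (L z) • L := by
    ext1 z
    exact (h z).fderiv
  rw [this]
  exact (ExpGrowth.cexp_clm L).smul (.const L)

theorem of_test {f : Cn n → ℂ} (hf : f ∈ testFunctions n) : ExpGrowthC1 f := by
  have h' : Continuous (fderiv ℝ f) := hf.1.continuous_fderiv (by simp)
  obtain ⟨C, hC⟩ := hf.2.exists_bound_of_continuous hf.1.continuous
  obtain ⟨C', hC'⟩ := (hf.2.fderiv (𝕜 := ℝ)).exists_bound_of_continuous h'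
  exact ⟨hf.1.differentiable (by simp), .of_bounded hf.1.continuous hC, .of_bounded h' hC'⟩

theorem fderiv_apply {f : Cn n → ℂ} (hf : ExpGrowthC1 f) (v : Cn n) :
    ExpGrowth fun z => fderiv ℝ f z v :=
  .of_le_mul (hf.2.2.1.clm_apply continuous_const) hf.2.2 (.const v)
    fun z => (fderiv ℝ f z).le_opNorm v

theorem dz {f : Cn n → ℂ} (hf : ExpGrowthC1 f) (j : Fin n) : ExpGrowth (dz j f) := by
  have h := ((hf.fderiv_apply (EuclideanSpace.single j 1)).add
    ((ExpGrowth.const (-Complex.I)).mul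
      (hf.fderiv_apply (EuclideanSpace.single j Complex.I)))).mul (.const (1 / 2))
  convert h using 2 with z
  simp only [_root_.dz]
  ring

theorem dzbar {f : Cn n → ℂ} (hf : ExpGrowthC1 f) (j : Fin n) : ExpGrowth (dzbar j f) := by
  have h := ((hf.fderiv_apply (EuclideanSpace.single j 1)).add
    ((ExpGrowth.const Complex.I).mul
      (hf.fderiv_apply (EuclideanSpace.single j Complex.I)))).mul (.const (1 / 2))
  convert h using 2 with z
  simp only [_root_.dzbar]
  ring

end ExpGrowthC1

theorem integral_fderiv_apply_eq_zero {f : Cn n → ℂ} (hf : Differentiable ℝ f) (hi : Integrable f)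
    {v : Cn n} (hi' : Integrable fun z => fderiv ℝ f z v) : ∫ z, fderiv ℝ f z v = 0 := by
  have h := integral_mul_fderiv_eq_neg_fderiv_mul_of_integrable (μ := (volume : Measure (Cn n)))
    (f := fun _ : Cn n => (1 : ℂ)) (g := f) (v := v) (by simp) (by simpa using hi')
    (by simpa using hi) (fun _ _ => differentiableAt_const _) (fun z _ => hf z)
  simpa using h

theorem integral_fderiv_mul_gaussian {f : Cn n → ℂ} (hf : ExpGrowthC1 f) {τ : ℝ} (hτ : 0 < τ)
    (v : Cn n) :
    Integrable (fun z => fderiv ℝ (fun z => f z * gaussian τ z) z v) ∧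
      ∫ z, fderiv ℝ (fun z => f z * gaussian τ z) z v = 0 := by
  have hg : Differentiable ℝ (gaussian (n := n) τ) :=
    (contDiff_gaussian τ).differentiable (by simp)
  have hg' : ∀ z, fderiv ℝ (gaussian (n := n) τ) z v
      = -τ * ((2 * inner ℝ z v : ℝ) : ℂ) * gaussian τ z := by
    intro z
    have hd : DifferentiableAt ℝ (fun z : Cn n => ((‖z‖ ^ 2 : ℝ) : ℂ)) z :=
      contDiff_norm_sq_complex.differentiable (by simp) z
    rw [gaussian_eq_cexp, (hd.hasFDerivAt.const_mul (-τ : ℂ)).cexp.fderiv]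
    simp only [smul_apply, fderiv_ofReal_norm_sq, smul_eq_mul]
    ring
  have heq : ∀ z, fderiv ℝ (fun z => f z * gaussian τ z) z v
      = (fderiv ℝ f z v + -τ * ((2 * inner ℝ z v : ℝ) : ℂ) * f z) * gaussian τ z := by
    intro z
    rw [fderiv_fun_mul (hf.1 z) (hg z)]
    simp only [add_apply, smul_apply, hg', smul_eq_mul]
    ring
  have hin : ExpGrowth fun z : Cn n => ((2 * inner ℝ z v : ℝ) : ℂ) := by
    convert ExpGrowth.clm (Complex.ofRealCLM.comp ((2 : ℝ) • innerSL ℝ v)) using 2 with z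
    simp [real_inner_comm]
  have hint : Integrable fun z => fderiv ℝ (fun z => f z * gaussian τ z) z v := by
    simp only [heq]
    exact ((hf.fderiv_apply v).add (((ExpGrowth.const (-τ : ℂ)).mul hin).mul
      hf.2.1)).integrable_mul_gaussian hτ
  exact ⟨hint, integral_fderiv_apply_eq_zero (hf.1.mul hg)
    (hf.2.1.integrable_mul_gaussian hτ) hint⟩

/-- Integration by parts against `e^{-τ|z|²}`, for `∂/∂z_j`. -/
theorem integral_dz_mul_gaussian {f : Cn n → ℂ} (hf : ExpGrowthC1 f) {τ : ℝ} (hτ : 0 < τ)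
    (j : Fin n) :
    ∫ z, dz j f z * gaussian τ z = τ * ∫ z, conj (z j) * f z * gaussian τ z := by
  obtain ⟨i1, e1⟩ := integral_fderiv_mul_gaussian hf hτ (EuclideanSpace.single j 1)
  obtain ⟨i2, e2⟩ := integral_fderiv_mul_gaussian hf hτ (EuclideanSpace.single j Complex.I)
  have h0 : ∫ z, dz j (fun z => f z * gaussian τ z) z = 0 := by
    simp only [dz]
    rw [integral_div, integral_sub i1 (i2.const_mul _), integral_const_mul, e1, e2]
    simp
  have hg : Differentiable ℝ (gaussian (n := n) τ) :=
    (contDiff_gaussian τ).differentiable (by simp)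
  have heq : ∀ z, dz j (fun z => f z * gaussian τ z) z
      = dz j f z * gaussian τ z - τ * (conj (z j) * f z * gaussian τ z) := by
    intro z
    rw [dz_mul (hf.1 z) (hg z), dz_gaussian]
    ring
  simp only [heq] at h0
  rw [integral_sub ((hf.dz j).integrable_mul_gaussian hτ)
    ((((ExpGrowth.conj_coord j).mul hf.2.1).integrable_mul_gaussian hτ).const_mul _),
    integral_const_mul] at h0
  exact sub_eq_zero.mp h0

/-- Integration by parts against `e^{-τ|z|²}`, for `∂/∂z̄_j`. -/
theorem integral_dzbar_mul_gaussian {f : Cn n → ℂ} (hf : ExpGrowthC1 f) {τ : ℝ} (hτ : 0 < τ)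
    (j : Fin n) :
    ∫ z, dzbar j f z * gaussian τ z = τ * ∫ z, z j * f z * gaussian τ z := by
  obtain ⟨i1, e1⟩ := integral_fderiv_mul_gaussian hf hτ (EuclideanSpace.single j 1)
  obtain ⟨i2, e2⟩ := integral_fderiv_mul_gaussian hf hτ (EuclideanSpace.single j Complex.I)
  have h0 : ∫ z, dzbar j (fun z => f z * gaussian τ z) z = 0 := by
    simp only [dzbar]
    rw [integral_div, integral_add i1 (i2.const_mul _), integral_const_mul, e1, e2]
    simp
  have hg : Differentiable ℝ (gaussian (n := n) τ) :=
    (contDiff_gaussian τ).differentiable (by simp)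
  have heq : ∀ z, dzbar j (fun z => f z * gaussian τ z) z
      = dzbar j f z * gaussian τ z - τ * (z j * f z * gaussian τ z) := by
    intro z
    rw [dzbar_mul (hf.1 z) (hg z), dzbar_gaussian]
    ring
  simp only [heq] at h0
  rw [integral_sub ((hf.dzbar j).integrable_mul_gaussian hτ)
    ((((ExpGrowth.coord j).mul hf.2.1).integrable_mul_gaussian hτ).const_mul _),
    integral_const_mul] at h0
  exact sub_eq_zero.mp h0

end Growth

/-! ### Symmetry of the magnetic Laplacian on test functions -/

section Symmetry

variable {n : ℕ}

theorem inner_toLp {f g : Cn n → ℂ} (hf : MemLp f 2 (gaussMeasure n))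
    (hg : MemLp g 2 (gaussMeasure n)) :
    inner ℂ (hf.toLp f) (hg.toLp g) = ∫ z, conj (f z) * g z ∂gaussMeasure n := by
  rw [L2.inner_def]
  refine integral_congr_ae ?_
  filter_upwards [hf.coeFn_toLp, hg.coeFn_toLp] with z h1 h2
  rw [h1, h2, RCLike.inner_apply, mul_comm]

/-- The Dirichlet form: `-∂_{z_j} + z̄_j` is the adjoint of `∂/∂z̄_j` in `L²(e^{-|z|²} dν)`. -/
theorem integral_conj_mul_magneticExpr {f g : Cn n → ℂ} (hf : f ∈ testFunctions n)
    (hg : g ∈ testFunctions n) :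
    ∫ z, conj (f z) * magneticExpr g z ∂gaussMeasure n
      = ∑ j, ∫ z, conj (dzbar j f z) * dzbar j g z ∂gaussMeasure n := by
  have hf1 := ExpGrowthC1.of_test hf
  have hcf : ExpGrowthC1 fun z => conj (f z) := by
    refine ExpGrowthC1.of_test ⟨Complex.conjCLE.contDiff.comp hf.1, ?_⟩
    exact hf.2.comp_left (g := conj) (map_zero _)
  have hd : ∀ j, ExpGrowthC1 (dzbar j g) := fun j => .of_test (dzbar_mem hg j)
  have hgr : ∀ j, ExpGrowth fun z => conj (dzbar j f z) * dzbar j g z :=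
    fun j => ((hf1.dzbar j).star).mul (hd j).2.1
  have hz : ∀ j, ExpGrowth fun z => conj (z j) * (conj (f z) * dzbar j g z) :=
    fun j => (ExpGrowth.conj_coord j).mul (hcf.2.1.mul (hd j).2.1)
  have hb : ∀ j, ExpGrowth fun z => conj (f z) * dz j (dzbar j g) z :=
    fun j => hcf.2.1.mul ((hd j).dz j)
  have key : ∀ j, ∫ z, (conj (z j) * (conj (f z) * dzbar j g z)
        - conj (f z) * dz j (dzbar j g) z) * gaussian 1 z
      = ∫ z, conj (dzbar j f z) * dzbar j g z * gaussian 1 z := by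
    intro j
    have h := integral_dz_mul_gaussian (hcf.mul (hd j)) one_pos j
    simp only [dz_mul (hcf.1 _) ((hd j).1 _), dz_conj (hf1.1 _)] at h
    rw [Complex.ofReal_one, one_mul] at h
    simp only [sub_mul, add_mul] at h ⊢
    rw [integral_add ((hgr j).integrable_mul_gaussian one_pos)
      ((hb j).integrable_mul_gaussian one_pos)] at h
    rw [integral_sub ((hz j).integrable_mul_gaussian one_pos)
      ((hb j).integrable_mul_gaussian one_pos), ← h]
    ring
  simp only [integral_gaussMeasure, ← key]
  rw [← integral_finsetSum]
  · refine integral_congr_ae (Filter.Eventually.of_forall fun z => ?_)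
    simp only [magneticExpr, ← Finset.sum_mul, Finset.sum_sub_distrib, mul_add, mul_neg,
      Finset.mul_sum]
    rw [neg_add_eq_sub]
    congr 2
    exact Finset.sum_congr rfl fun j _ => by ring
  · intro j _
    simp only [sub_mul]
    exact ((hz j).integrable_mul_gaussian one_pos).sub ((hb j).integrable_mul_gaussian one_pos)

theorem inner_magneticTest_comm (f g : testFunctions n) :
    inner ℂ (testToL2 n (magneticTest n f)) (testToL2 n g)
      = inner ℂ (testToL2 n f) (testToL2 n (magneticTest n g)) := by
  have h : ∀ f g : testFunctions n,
      inner ℂ (testToL2 n f) (testToL2 n (magneticTest n g))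
        = ∑ j, ∫ z, conj (dzbar j f.1 z) * dzbar j g.1 z ∂gaussMeasure n := by
    intro f g
    rw [← integral_conj_mul_magneticExpr f.2 g.2]
    exact inner_toLp (testFunctions_memLp f.2) (testFunctions_memLp (magneticExpr_mem g.2))
  rw [← inner_conj_symm, h, h, map_sum]
  refine Finset.sum_congr rfl fun j _ => ?_
  rw [← integral_conj]
  refine integral_congr_ae (Filter.Eventually.of_forall fun z => ?_)
  simp [mul_comm]

theorem mem_graph_magneticLaplacian₀ (f : testFunctions n) :
    (testToL2 n f, testToL2 n (magneticTest n f)) ∈ (magneticLaplacian₀ n).graph := by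
  rw [LinearPMap.mem_graph_iff]
  refine ⟨⟨testToL2 n f, f, rfl⟩, rfl, ?_⟩
  change testToL2 n (magneticTest n ((LinearEquiv.ofInjective (testToL2 n)
    (testToL2_injective n)).symm ((LinearEquiv.ofInjective (testToL2 n)
    (testToL2_injective n)) f))) = _
  rw [LinearEquiv.symm_apply_apply]

theorem exists_of_mem_graph_magneticLaplacian₀ {q : GaussL2 n × GaussL2 n}
    (hq : q ∈ (magneticLaplacian₀ n).graph) :
    ∃ f : testFunctions n, q = (testToL2 n f, testToL2 n (magneticTest n f)) := by
  obtain ⟨⟨x, f, hf⟩, hx, hAx⟩ := (LinearPMap.mem_graph_iff _).mp hq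
  have h := mem_graph_magneticLaplacian₀ f
  refine ⟨f, Prod.ext (hx.symm.trans hf.symm) ?_⟩
  exact LinearPMap.mem_graph_snd_inj' _ hq h (hx.symm.trans hf.symm)

theorem magneticLaplacian₀_isFormalAdjoint :
    (magneticLaplacian₀ n).IsFormalAdjoint (magneticLaplacian₀ n) := by
  intro x y
  obtain ⟨f, hf⟩ := exists_of_mem_graph_magneticLaplacian₀ ((magneticLaplacian₀ n).mem_graph x)
  obtain ⟨g, hg⟩ := exists_of_mem_graph_magneticLaplacian₀ ((magneticLaplacian₀ n).mem_graph y)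
  rw [Prod.ext_iff] at hf hg
  simp only at hf hg
  rw [hf.1, hf.2, hg.1, hg.2]
  exact inner_magneticTest_comm f g

end Symmetry

section Closure

variable {H : Type*} [NormedAddCommGroup H] [InnerProductSpace ℂ H]

theorem isClosable_of_symmetric [CompleteSpace H] {A : H →ₗ.[ℂ] H} (hd : Dense (A.domain : Set H))
    (hsymm : A.IsFormalAdjoint A) : A.IsClosable :=
  (LinearPMap.adjoint_isClosed hd).isClosable.leIsClosable (hsymm.le_adjoint hd)

theorem closure_isFormalAdjoint {A : H →ₗ.[ℂ] H} (hc : A.IsClosable)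
    (hsymm : A.IsFormalAdjoint A) : A.closure.IsFormalAdjoint A.closure := by
  have hcl : ∀ q ∈ A.closure.graph, q ∈ closure (A.graph : Set (H × H)) := by
    intro q hq
    rw [← hc.graph_closure_eq_closure_graph] at hq
    exact hq
  have h0 : ∀ q ∈ A.graph, ∀ r ∈ A.graph, inner ℂ q.2 r.1 = inner ℂ q.1 r.2 := by
    intro q hq r hr
    obtain ⟨x, hx, hx'⟩ := A.mem_graph_iff.mp hq
    obtain ⟨y, hy, hy'⟩ := A.mem_graph_iff.mp hr
    rw [← hx, ← hx', ← hy, ← hy']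
    exact hsymm x y
  have h1 : ∀ q ∈ A.graph, ∀ r ∈ closure (A.graph : Set (H × H)),
      inner ℂ q.2 r.1 = inner ℂ q.1 r.2 := by
    intro q hq r hr
    have hC : IsClosed {r : H × H | inner ℂ q.2 r.1 = inner ℂ q.1 r.2} :=
      isClosed_eq (by fun_prop) (by fun_prop)
    exact closure_minimal (fun r hr => h0 q hq r hr) hC hr
  intro x y
  have hC : IsClosed {q : H × H | inner ℂ q.2 (y : H) = inner ℂ q.1 (A.closure y)} :=
    isClosed_eq (by fun_prop) (by fun_prop)
  exact closure_minimal (fun q hq => h1 q hq _ (hcl _ (A.closure.mem_graph y))) hC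
    (hcl _ (A.closure.mem_graph x))

theorem mem_closure_graph_of_tendsto {A : H →ₗ.[ℂ] H} (hc : A.IsClosable) {x y : H}
    {u w : ℕ → H} (hu : ∀ i, (u i, w i) ∈ A.graph) (hx : Filter.Tendsto u Filter.atTop (nhds x))
    (hy : Filter.Tendsto w Filter.atTop (nhds y)) : (x, y) ∈ A.closure.graph := by
  rw [← hc.graph_closure_eq_closure_graph]
  exact mem_closure_of_tendsto (hx.prodMk_nhds hy) (Filter.Eventually.of_forall hu)

end Closure

/-! ### Eigenfunctions and cutoffs -/

section Eigenfunctions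

variable {n : ℕ}

/-- The function `e^{p·z} (s·(z̄ - p))^k` of the `k`-th Landau level, where `p·z = ∑ p_j z_j`. -/
def landau (p s : Fin n → ℂ) (k : ℕ) (z : Cn n) : ℂ :=
  Complex.exp (dot p z) * (cdot s z - ∑ j, s j * p j) ^ k

theorem contDiff_landau (p s : Fin n → ℂ) (k : ℕ) : ContDiff ℝ ∞ (landau p s k) :=
  ((dot p).contDiff.cexp).mul (((cdot s).contDiff.sub contDiff_const).pow k)

theorem expGrowthC1_landau (p s : Fin n → ℂ) (k : ℕ) : ExpGrowthC1 (landau p s k) := by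
  have h := (ExpGrowthC1.clm (cdot s)).add (.const (-∑ j, s j * p j))
  simp only [← sub_eq_add_neg] at h
  exact (ExpGrowthC1.cexp_clm (dot p)).mul (h.pow k)

theorem expGrowth_landau (p s : Fin n → ℂ) (k : ℕ) : ExpGrowth (landau p s k) :=
  (expGrowthC1_landau p s k).2.1

theorem dz_landau (p s : Fin n → ℂ) (k : ℕ) (j : Fin n) (z : Cn n) :
    dz j (landau p s k) z = p j * landau p s k z := by
  have h1 : DifferentiableAt ℝ (fun z => cdot s z - ∑ j, s j * p j) z := by fun_prop
  have h2 : dz j (fun z => cdot s z - ∑ j, s j * p j) z = 0 := by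
    simp only [sub_eq_add_neg]
    rw [dz_fun_add (cdot s).differentiableAt (differentiableAt_const _), dz_const]
    simpa using dz_cdot s j z
  have h3 : dz j (fun z => (cdot s z - ∑ j, s j * p j) ^ k) z = 0 := by
    rw [dz_comp (hasDerivAt_pow k _) h1, h2, mul_zero]
  have h4 : dz j (fun z => Complex.exp (dot p z)) z = Complex.exp (dot p z) * p j := by
    rw [dz_comp (Complex.hasDerivAt_exp _) (dot p).differentiableAt]
    congr 1
    exact dz_dot p j z
  unfold landau
  rw [dz_mul (dot p).differentiableAt.cexp (h1.fun_pow k), h3, h4]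
  ring

theorem dzbar_landau (p s : Fin n → ℂ) (k : ℕ) (j : Fin n) (z : Cn n) :
    dzbar j (landau p s k) z = k * s j * landau p s (k - 1) z := by
  have h1 : DifferentiableAt ℝ (fun z => cdot s z - ∑ j, s j * p j) z := by fun_prop
  have h2 : dzbar j (fun z => cdot s z - ∑ j, s j * p j) z = s j := by
    simp only [sub_eq_add_neg]
    rw [dzbar_fun_add (cdot s).differentiableAt (differentiableAt_const _), dzbar_const, add_zero]
    exact dzbar_cdot s j z
  have h3 : dzbar j (fun z => (cdot s z - ∑ j, s j * p j) ^ k) z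
      = k * (cdot s z - ∑ j, s j * p j) ^ (k - 1) * s j := by
    rw [dzbar_comp (hasDerivAt_pow k _) h1, h2]
  have h4 : dzbar j (fun z => Complex.exp (dot p z)) z = 0 := by
    rw [dzbar_comp (Complex.hasDerivAt_exp _) (dot p).differentiableAt]
    have := dzbar_dot p j z
    rw [show dzbar j (fun z => dot p z) z = 0 from this, mul_zero]
  unfold landau
  rw [dzbar_mul (dot p).differentiableAt.cexp (h1.fun_pow k), h3, h4]
  ring

theorem dzbar_landau_eq (p s : Fin n → ℂ) (k : ℕ) (j : Fin n) :
    dzbar j (landau p s k) = fun z => k * s j * landau p s (k - 1) z :=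
  funext fun z => dzbar_landau p s k j z

theorem dz_dzbar_landau (p s : Fin n → ℂ) (k : ℕ) (j : Fin n) (z : Cn n) :
    dz j (dzbar j (landau p s k)) z = p j * (k * s j * landau p s (k - 1) z) := by
  rw [dzbar_landau_eq, dz_mul (differentiableAt_const _) ((expGrowthC1_landau p s _).1 z),
    dz_const, dz_landau]
  ring

theorem magneticExpr_landau (p s : Fin n → ℂ) (k : ℕ) (z : Cn n) :
    magneticExpr (landau p s k) z = k * landau p s k z := by
  have h : magneticExpr (landau p s k) z
      = k * ((cdot s z - ∑ j, s j * p j) * landau p s (k - 1) z) := by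
    simp only [magneticExpr, dz_dzbar_landau, dzbar_landau]
    rw [neg_add_eq_sub, ← Finset.sum_sub_distrib, cdot_apply, ← Finset.sum_sub_distrib,
      Finset.sum_mul, Finset.mul_sum]
    exact Finset.sum_congr rfl fun j _ => by ring
  rw [h]
  rcases k with _ | k
  · simp
  · simp only [landau, Nat.add_sub_cancel]
    ring

/-- Leibniz rule for the magnetic Laplacian. -/
theorem magneticExpr_mul {χ v : Cn n → ℂ} (hχ : ContDiff ℝ 2 χ) (hv : ContDiff ℝ 2 v)
    (hχ' : ∀ j, Differentiable ℝ (dzbar j χ)) (hv' : ∀ j, Differentiable ℝ (dzbar j v))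
    (z : Cn n) :
    magneticExpr (fun z => χ z * v z) z = χ z * magneticExpr v z
      + ∑ j, (conj (z j) * v z * dzbar j χ z - dz j χ z * dzbar j v z - dzbar j χ z * dz j v z
        - v z * dz j (dzbar j χ) z) := by
  have dχ : Differentiable ℝ χ := hχ.differentiable (by simp)
  have dv : Differentiable ℝ v := hv.differentiable (by simp)
  have h1 : ∀ j, dzbar j (fun z => χ z * v z) = fun z => dzbar j χ z * v z + χ z * dzbar j v z :=
    fun j => funext fun z => dzbar_mul (dχ z) (dv z) j
  have h2 : ∀ j, dz j (dzbar j (fun z => χ z * v z)) z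
      = dz j (dzbar j χ) z * v z + dzbar j χ z * dz j v z
        + (dz j χ z * dzbar j v z + χ z * dz j (dzbar j v) z) := by
    intro j
    rw [h1, dz_fun_add ((hχ' j z).fun_mul (dv z)) ((dχ z).fun_mul (hv' j z)), dz_mul (hχ' j z) (dv z),
      dz_mul (dχ z) (hv' j z)]
  simp only [magneticExpr]
  simp_rw [h2, h1]
  rw [mul_add, mul_neg, Finset.mul_sum, Finset.mul_sum, ← Finset.sum_neg_distrib,
    ← Finset.sum_neg_distrib, ← Finset.sum_add_distrib, ← Finset.sum_add_distrib,
    ← Finset.sum_add_distrib]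
  exact Finset.sum_congr rfl fun j _ => by ring

theorem dz_comp_smul (f : Cn n → ℂ) (r : ℝ) (j : Fin n) (z : Cn n) :
    dz j (fun z => f (r • z)) z = r * dz j f (r • z) := by
  simp only [dz, fderiv_comp_smul, smul_apply, Complex.real_smul]
  ring

theorem dzbar_comp_smul (f : Cn n → ℂ) (r : ℝ) (j : Fin n) (z : Cn n) :
    dzbar j (fun z => f (r • z)) z = r * dzbar j f (r • z) := by
  simp only [dzbar, fderiv_comp_smul, smul_apply, Complex.real_smul]
  ring

theorem exists_cutoff (n : ℕ) : ∃ θ ∈ testFunctions n, ∀ z : Cn n, ‖z‖ ≤ 1 → θ z = 1 := by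
  let b : ContDiffBump (0 : Cn n) := ⟨1, 2, one_pos, one_lt_two⟩
  refine ⟨fun z => ((b z : ℝ) : ℂ), ⟨Complex.ofRealCLM.contDiff.comp b.contDiff,
    b.hasCompactSupport.comp_left (g := Complex.ofReal) Complex.ofReal_zero⟩, fun z hz => ?_⟩
  simp [b.one_of_mem_closedBall (by simpa using hz : z ∈ Metric.closedBall (0 : Cn n) b.rIn)]

theorem comp_smul_mem {f : Cn n → ℂ} (hf : f ∈ testFunctions n) {r : ℝ} (hr : r ≠ 0) :
    (fun z => f (r • z)) ∈ testFunctions n :=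
  ⟨hf.1.comp (contDiff_const_smul r), hf.2.comp_smul hr⟩

theorem exists_bound_test {f : Cn n → ℂ} (hf : f ∈ testFunctions n) : ∃ C, ∀ z, ‖f z‖ ≤ C :=
  hf.2.exists_bound_of_continuous hf.1.continuous

/-- Dominated convergence in `L²`. -/
theorem tendsto_toLp_of_dominated {α : Type*} [MeasurableSpace α] {μ : Measure α}
    {f : ℕ → α → ℂ} {g : α → ℂ} {G : α → ℝ}
    (hf : ∀ i, MemLp (f i) 2 μ) (hg : MemLp g 2 μ) (hG : MemLp G 2 μ)
    (hb : ∀ i x, ‖f i x‖ ≤ G x)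
    (hlim : ∀ x, Filter.Tendsto (fun i => f i x) Filter.atTop (nhds (g x))) :
    Filter.Tendsto (fun i => (hf i).toLp (f i)) Filter.atTop (nhds (hg.toLp g)) := by
  rw [tendsto_iff_norm_sub_tendsto_zero]
  have h1 : ∀ i, ‖(hf i).toLp (f i) - hg.toLp g‖ ^ 2 = ∫ x, ‖f i x - g x‖ ^ 2 ∂μ := by
    intro i
    rw [← MemLp.toLp_sub, ← real_inner_self_eq_norm_sq, L2.inner_def]
    refine integral_congr_ae ?_
    filter_upwards [((hf i).sub hg).coeFn_toLp] with x hx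
    rw [hx, real_inner_self_eq_norm_sq]
    rfl
  have hgG : ∀ x, ‖g x‖ ≤ G x := fun x =>
    le_of_tendsto (hlim x).norm (Filter.Eventually.of_forall fun i => hb i x)
  have h2 : Filter.Tendsto (fun i => ∫ x, ‖f i x - g x‖ ^ 2 ∂μ) Filter.atTop (nhds 0) := by
    rw [show (0 : ℝ) = ∫ _x, (0 : ℝ) ∂μ by simp]
    refine tendsto_integral_of_dominated_convergence (fun x => (2 * G x) ^ 2)
      (fun i => (((hf i).sub hg).aestronglyMeasurable.norm.pow 2)) ?_
      (fun i => Filter.Eventually.of_forall fun x => ?_)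
      (Filter.Eventually.of_forall fun x => ?_)
    · exact (hG.const_mul 2).integrable_sq
    · rw [Real.norm_of_nonneg (by positivity)]
      gcongr
      linarith [norm_sub_le (f i x) (g x), hb i x, hgG x]
    · have := ((hlim x).sub_const (g x)).norm.pow 2
      simpa using this
  have h3 := h2.congr fun i => (h1 i).symm
  have h4 := (Real.continuous_sqrt.tendsto 0).comp h3
  simpa [Function.comp_def, Real.sqrt_sq] using h4

/-- The eigenfunctions are limits, in the graph norm, of their products with the cutoffs
`θ(z / (i + 1))`: near each point the products are eventually equal to the eigenfunction, and by
the Leibniz rule they are dominated, with their images, by functions of exponential growth. -/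
theorem exists_test_tendsto_landau (p s : Fin n → ℂ) (k : ℕ) :
    ∃ f : ℕ → testFunctions n,
      Filter.Tendsto (fun i => testToL2 n (f i)) Filter.atTop
        (nhds ((expGrowth_landau p s k).memLp.toLp (landau p s k))) ∧
      Filter.Tendsto (fun i => testToL2 n (magneticTest n (f i))) Filter.atTop
        (nhds ((k : ℂ) • (expGrowth_landau p s k).memLp.toLp (landau p s k))) := by
  obtain ⟨θ, hθ, hθ1⟩ := exists_cutoff n
  -- a common bound for `θ` and its derivatives
  obtain ⟨M, hM0, hM, hMz, hMb, hMzb⟩ : ∃ M : ℝ, 0 ≤ M ∧ (∀ z, ‖θ z‖ ≤ M) ∧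
      (∀ j z, ‖dz j θ z‖ ≤ M) ∧ (∀ j z, ‖dzbar j θ z‖ ≤ M) ∧
      (∀ j z, ‖dz j (dzbar j θ) z‖ ≤ M) := by
    obtain ⟨C, hC⟩ := exists_bound_test hθ
    choose C₁ hC₁ using fun j => exists_bound_test (dz_mem hθ j)
    choose C₂ hC₂ using fun j => exists_bound_test (dzbar_mem hθ j)
    choose C₃ hC₃ using fun j => exists_bound_test (dz_mem (dzbar_mem hθ j) j)
    have h0 : 0 ≤ C := (norm_nonneg _).trans (hC 0)
    have h1 : ∀ j, 0 ≤ C₁ j := fun j => (norm_nonneg _).trans (hC₁ j 0)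
    have h2 : ∀ j, 0 ≤ C₂ j := fun j => (norm_nonneg _).trans (hC₂ j 0)
    have h3 : ∀ j, 0 ≤ C₃ j := fun j => (norm_nonneg _).trans (hC₃ j 0)
    have hs : ∀ j, C₁ j + C₂ j + C₃ j ≤ ∑ j, (C₁ j + C₂ j + C₃ j) := fun j =>
      Finset.single_le_sum (f := fun j => C₁ j + C₂ j + C₃ j)
        (fun i _ => by linarith [h1 i, h2 i, h3 i]) (Finset.mem_univ j)
    have hs0 : 0 ≤ ∑ j, (C₁ j + C₂ j + C₃ j) :=
      Finset.sum_nonneg fun i _ => by linarith [h1 i, h2 i, h3 i]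
    refine ⟨C + ∑ j, (C₁ j + C₂ j + C₃ j), by positivity, fun z => ?_, fun j z => ?_, fun j z => ?_,
      fun j z => ?_⟩
    · linarith [hC z]
    · linarith [hC₁ j z, hs j, h1 j, h2 j, h3 j]
    · linarith [hC₂ j z, hs j, h1 j, h2 j, h3 j]
    · linarith [hC₃ j z, hs j, h1 j, h2 j, h3 j]
  let r : ℕ → ℝ := fun i => ((i : ℝ) + 1)⁻¹
  have hr0 : ∀ i, 0 < r i := fun i => by positivity
  have hr1 : ∀ i, r i ≤ 1 := fun i => inv_le_one_of_one_le₀ (by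
    have : (0 : ℝ) ≤ i := by positivity
    linarith)
  let χ : ℕ → Cn n → ℂ := fun i z => θ (r i • z)
  have hχ : ∀ i, χ i ∈ testFunctions n := fun i => comp_smul_mem hθ (hr0 i).ne'
  set v := landau p s k with hv
  have hvs : ContDiff ℝ ∞ v := contDiff_landau p s k
  have hf : ∀ i, (fun z => χ i z * v z) ∈ testFunctions n := fun i =>
    ⟨(hχ i).1.mul hvs, (hχ i).2.mul_right⟩
  -- near each point the cutoffs are eventually `1`
  have hone : ∀ z : Cn n, ∀ᶠ i in Filter.atTop, (fun y => χ i y * v y) =ᶠ[nhds z] v := by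
    intro z
    obtain ⟨N, hN⟩ := exists_nat_ge (‖z‖ + 1)
    filter_upwards [Filter.eventually_ge_atTop N] with i hi
    have : ∀ᶠ y in nhds z, ‖y‖ < ‖z‖ + 1 :=
      continuous_norm.continuousAt.eventually_lt continuousAt_const (by simp)
    filter_upwards [this] with y hy
    have h1 : ‖r i • y‖ ≤ 1 := by
      rw [norm_smul, Real.norm_of_nonneg (hr0 i).le, inv_mul_le_iff₀ (by positivity), mul_one]
      have : (N : ℝ) ≤ i := by exact_mod_cast hi
      linarith
    simp [χ, hθ1 _ h1]
  have hdzb : ∀ i j, dzbar j (χ i) = fun z => (r i : ℂ) * dzbar j θ (r i • z) :=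
    fun i j => funext fun z => dzbar_comp_smul θ (r i) j z
  have hdz : ∀ i j z, dz j (χ i) z = (r i : ℂ) * dz j θ (r i • z) :=
    fun i j z => dz_comp_smul θ (r i) j z
  have hdzdzb : ∀ i j z, dz j (dzbar j (χ i)) z
      = (r i : ℂ) * ((r i : ℂ) * dz j (dzbar j θ) (r i • z)) := by
    intro i j z
    have hd : Differentiable ℝ fun z => dzbar j θ (r i • z) :=
      (comp_smul_mem (dzbar_mem hθ j) (hr0 i).ne').1.differentiable (by simp)
    rw [hdzb, dz_mul (differentiableAt_const _) (hd z), dz_const, dz_comp_smul]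
    ring
  have hrn : ∀ i, ‖(r i : ℂ)‖ ≤ 1 := fun i => by
    rw [Complex.norm_real, Real.norm_of_nonneg (hr0 i).le]
    exact hr1 i
  have hmul : ∀ i (a : ℂ), ‖a‖ ≤ M → ‖(r i : ℂ) * a‖ ≤ M := fun i a ha => by
    rw [norm_mul]
    calc _ ≤ 1 * M := mul_le_mul (hrn i) ha (norm_nonneg _) zero_le_one
      _ = M := one_mul M
  have hv1 := expGrowthC1_landau p s k
  have hvb : ∀ j, ExpGrowth (dzbar j v) := fun j => hv1.dzbar j
  -- the dominating function
  let G : Cn n → ℝ := fun z => M * (k * ‖v z‖) +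
    ∑ j, M * (‖z j‖ * ‖v z‖ + ‖dzbar j v z‖ + ‖dz j v z‖ + ‖v z‖)
  have hGm : MemLp G 2 (gaussMeasure n) := by
    have hn : ∀ {f : Cn n → ℂ}, ExpGrowth f → MemLp (fun z => ‖f z‖) 2 (gaussMeasure n) :=
      fun hf => hf.memLp.norm
    refine (((hn hv1.2.1).const_mul k).const_mul M).add (memLp_finsetSum _ fun j _ => ?_)
    refine MemLp.const_mul (((MemLp.add ?_ (hn (hvb j))).add (hn (hv1.dz j))).add (hn hv1.2.1)) M
    simpa only [norm_mul] using hn ((ExpGrowth.coord j).mul hv1.2.1)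
  refine ⟨fun i => ⟨_, hf i⟩, ?_, ?_⟩
  · refine tendsto_toLp_of_dominated (fun i => testFunctions_memLp (hf i)) _
      (G := fun z => M * ‖v z‖) (hv1.2.1.memLp.norm.const_mul M) (fun i z => ?_) fun z => ?_
    · rw [norm_mul]
      exact mul_le_mul_of_nonneg_right (hM _) (norm_nonneg _)
    · refine tendsto_const_nhds.congr' ?_
      filter_upwards [hone z] with i hi
      exact hi.eq_of_nhds.symm
  · rw [← MemLp.toLp_const_smul]
    refine tendsto_toLp_of_dominated
      (fun i => testFunctions_memLp (magneticExpr_mem (hf i))) _ hGm (fun i z => ?_) fun z => ?_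
    · rw [magneticExpr_mul (contDiff_infty.mp (hχ i).1 2) (contDiff_infty.mp hvs 2)
        (fun j => (dzbar_mem (hχ i) j).1.differentiable (by simp))
        (fun j => by
          rw [dzbar_landau_eq]
          exact (expGrowthC1_landau p s _).1.const_mul _), hv, magneticExpr_landau, ← hv]
      refine (norm_add_le _ _).trans (add_le_add ?_ ((norm_sum_le _ _).trans
        (Finset.sum_le_sum fun j _ => ?_)))
      · rw [norm_mul, norm_mul, Complex.norm_natCast]
        exact mul_le_mul_of_nonneg_right (hM _) (by positivity)
      · rw [hdzdzb, hdz, hdzb]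
        have e1 := hmul i _ (hMz j (r i • z))
        have e2 := hmul i _ (hMb j (r i • z))
        have e3 := hmul i _ (hmul i _ (hMzb j (r i • z)))
        refine (norm_sub_le _ _).trans ?_
        refine (add_le_add_left ((norm_sub_le _ _).trans
          (add_le_add_left (norm_sub_le _ _) _)) _).trans ?_
        simp only [norm_mul, RCLike.norm_conj] at e1 e2 e3 ⊢
        have a1 := mul_le_mul_of_nonneg_left e2
          (mul_nonneg (norm_nonneg (z j)) (norm_nonneg (v z)))
        have a2 := mul_le_mul_of_nonneg_right e1 (norm_nonneg (dzbar j v z))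
        have a3 := mul_le_mul_of_nonneg_right e2 (norm_nonneg (dz j v z))
        have a4 := mul_le_mul_of_nonneg_left e3 (norm_nonneg (v z))
        linarith
    · refine tendsto_const_nhds.congr' ?_
      filter_upwards [hone z] with i hi
      have h1 : ∀ j, dzbar j (fun y => χ i y * v y) =ᶠ[nhds z] dzbar j v := fun j => by
        filter_upwards [hi.eventuallyEq_nhds] with y hy
        simp only [dzbar, hy.fderiv_eq]
      have h2 : magneticExpr (fun y => χ i y * v y) z = magneticExpr v z := by
        simp only [magneticExpr]
        congr 2
        · refine Finset.sum_congr rfl fun j _ => ?_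
          simp only [dz, (h1 j).fderiv_eq]
        · ext j
          rw [(h1 j).eq_of_nhds]
      change _ = magneticExpr (fun y => χ i y * v y) z
      rw [h2, hv, magneticExpr_landau]
      simp

end Eigenfunctions

/-! ### Totality of the eigenfunctions -/

section Totality

open scoped FourierTransform

/-- An integrable function is determined by its Fourier transform. -/
theorem ae_eq_zero_of_fourier_eq_zero {V : Type*} [NormedAddCommGroup V] [InnerProductSpace ℝ V]
    [FiniteDimensional ℝ V] [MeasurableSpace V] [BorelSpace V] {h : V → ℂ} (hi : Integrable h)
    (h0 : ∀ ξ, 𝓕 h ξ = 0) : ∀ᵐ x, h x = 0 := by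
  refine ae_eq_zero_of_integral_contDiff_smul_eq_zero hi.locallyIntegrable fun g hg hgc => ?_
  -- write the test function as a Fourier transform and move the transform to `h`
  have hgc' : HasCompactSupport fun x => ((g x : ℝ) : ℂ) :=
    hgc.comp_left (g := Complex.ofReal) Complex.ofReal_zero
  let G : SchwartzMap V ℂ := hgc'.toSchwartzMap (Complex.ofRealCLM.contDiff.comp hg)
  have h1 := VectorFourier.integral_fourierIntegral_smul_eq_flip (L := innerₗ V)
    (μ := (volume : Measure V)) (ν := (volume : Measure V)) (f := h) (g := (𝓕⁻ G : SchwartzMap V ℂ))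
    Real.continuous_fourierChar continuous_inner hi (SchwartzMap.integrable _)
  have h2 : ∀ ξ, VectorFourier.fourierIntegral Real.fourierChar volume (innerₗ V) h ξ = 0 := h0
  have h3 : ∀ x, VectorFourier.fourierIntegral Real.fourierChar volume (innerₗ V).flip
      ((𝓕⁻ G : SchwartzMap V ℂ) : V → ℂ) x = ((g x : ℝ) : ℂ) := by
    intro x
    rw [flip_innerₗ]
    have h4 : 𝓕 (𝓕⁻ G : SchwartzMap V ℂ) = G := FourierTransform.fourier_fourierInv_eq G
    have h5 : (𝓕 (𝓕⁻ G : SchwartzMap V ℂ) : SchwartzMap V ℂ) x = G x := by rw [h4]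
    rw [SchwartzMap.fourier_coe] at h5
    exact h5
  simp only [h2, h3, zero_smul, integral_zero] at h1
  rw [h1]
  refine integral_congr_ae (Filter.Eventually.of_forall fun x => ?_)
  simp [mul_comm]

variable {n : ℕ}

theorem inner_toLp_left {f : Cn n → ℂ} (hf : MemLp f 2 (gaussMeasure n)) (φ : GaussL2 n) :
    inner ℂ (hf.toLp f) φ = ∫ z, conj (f z) * φ z ∂gaussMeasure n := by
  rw [L2.inner_def]
  refine integral_congr_ae ?_
  filter_upwards [hf.coeFn_toLp] with z h1
  rw [h1, RCLike.inner_apply, mul_comm]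

theorem ExpGrowth.integrable_mul_Lp {f : Cn n → ℂ} (hf : ExpGrowth f) (φ : GaussL2 n) :
    Integrable (fun z => f z * φ z) (gaussMeasure n) :=
  hf.memLp.integrable_mul (Lp.memLp φ)

/-- A function orthogonal to all eigenfunctions is orthogonal to all exponentials `e^{p·z + s·z̄}`,
because `∑ₖ landau p s k / k! = e^{p·z + s·(z̄ - p)}`. -/
theorem integral_conj_exp_eq_zero {φ : GaussL2 n}
    (h : ∀ p s k, inner ℂ ((expGrowth_landau p s k).memLp.toLp (landau p s k)) φ = 0)
    (p s : Fin n → ℂ) :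
    ∫ z, conj (Complex.exp (dot p z) * Complex.exp (cdot s z)) * φ z ∂gaussMeasure n = 0 := by
  set c := ∑ j, s j * p j with hc
  let F : ℕ → Cn n → ℂ := fun k z => (k.factorial : ℂ)⁻¹ * (conj (landau p s k z) * φ z)
  have hF : ∀ k z, ‖F k z‖ = ‖cdot s z - c‖ ^ k / k.factorial
      * (‖Complex.exp (dot p z)‖ * ‖φ z‖) := by
    intro k z
    simp only [F, landau, norm_mul, norm_inv, Complex.norm_natCast, RCLike.norm_conj, norm_pow]
    ring
  have hs1 : ∀ z, HasSum (fun k => ‖F k z‖)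
      (Real.exp ‖cdot s z - c‖ * (‖Complex.exp (dot p z)‖ * ‖φ z‖)) := by
    intro z
    simp only [hF]
    have := NormedSpace.expSeries_div_hasSum_exp (𝔸 := ℝ) ‖cdot s z - c‖
    rw [← Real.exp_eq_exp_ℝ] at this
    exact this.mul_right _
  have hs2 : ∀ z, HasSum (fun k => F k z)
      (conj (Complex.exp (dot p z) * Complex.exp (cdot s z - c)) * φ z) := by
    intro z
    have h1 := NormedSpace.expSeries_div_hasSum_exp (𝔸 := ℂ) (cdot s z - c)
    rw [← Complex.exp_eq_exp_ℂ] at h1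
    have h2 := ((Complex.conjCLE.toContinuousLinearMap.hasSum
      (h1.mul_left (Complex.exp (dot p z)))).mul_right (φ z))
    have h3 : ∀ k, F k z = conj (Complex.exp (dot p z) *
        ((cdot s z - c) ^ k / (k.factorial : ℂ))) * φ z := by
      intro k
      simp only [F, landau, ← hc, map_mul, map_div₀, Complex.conj_natCast]
      ring
    simp only [h3]
    exact h2
  have hgr : ExpGrowth fun z => ((Real.exp ‖cdot s z - c‖ : ℝ) : ℂ) * Complex.exp (dot p z) := by
    refine ExpGrowth.mul ⟨by fun_prop, Real.exp ‖c‖, ‖cdot s‖, (Real.exp_pos _).le, norm_nonneg _,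
      fun z => ?_⟩ (.cexp_clm _)
    rw [Complex.norm_real, Real.norm_of_nonneg (Real.exp_pos _).le, ← Real.exp_add,
      Real.exp_le_exp]
    linarith [norm_sub_le (cdot s z) c, (cdot s).le_opNorm z]
  have key := hasSum_integral_of_dominated_convergence (μ := gaussMeasure n) (F := F)
    (fun k z => ‖F k z‖)
    (fun k => (((expGrowth_landau p s k).star.integrable_mul_Lp φ).const_mul
      (k.factorial : ℂ)⁻¹).aestronglyMeasurable)
    (fun k => Filter.Eventually.of_forall fun z => le_rfl)
    (Filter.Eventually.of_forall fun z => (hs1 z).summable)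
    (by
      simp only [(hs1 _).tsum_eq]
      refine (hgr.integrable_mul_Lp φ).norm.congr (Filter.Eventually.of_forall fun z => ?_)
      simp only [norm_mul, Complex.norm_real, Real.norm_of_nonneg (Real.exp_pos _).le, mul_assoc])
    (Filter.Eventually.of_forall hs2)
  have hz : ∀ k, ∫ z, F k z ∂gaussMeasure n = 0 := by
    intro k
    rw [integral_const_mul, ← inner_toLp_left (expGrowth_landau p s k).memLp, h, mul_zero]
  simp only [hz] at key
  have h0 := key.unique hasSum_zero
  have h1 : ∀ z, conj (Complex.exp (dot p z) * Complex.exp (cdot s z - c)) * φ z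
      = conj (Complex.exp (-c)) * (conj (Complex.exp (dot p z) * Complex.exp (cdot s z)) * φ z) := by
    intro z
    rw [sub_eq_add_neg, Complex.exp_add]
    simp only [map_mul]
    ring
  simp only [h1] at h0
  rw [integral_const_mul] at h0
  refine (mul_eq_zero.mp h0).resolve_left ?_
  simp [Complex.exp_ne_zero]

/-- For suitable `p` and `s` the function `e^{p·z + s·z̄}` is a character. -/
theorem conj_exp_dot_mul_exp_cdot (ξ z : Cn n) :
    conj (Complex.exp (dot (fun j => Real.pi * Complex.I * conj (ξ j)) z)
      * Complex.exp (cdot (fun j => Real.pi * Complex.I * ξ j) z))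
      = Complex.exp (((-2 * Real.pi * inner ℝ z ξ : ℝ) : ℂ) * Complex.I) := by
  have h : ((inner ℝ z ξ : ℝ) : ℂ) = ∑ j, (conj (ξ j) * z j + ξ j * conj (z j)) / 2 := by
    rw [PiLp.inner_apply, Complex.ofReal_sum]
    refine Finset.sum_congr rfl fun j _ => ?_
    apply Complex.ext
    · simp [Complex.inner]
    · simp [Complex.inner]
      ring
  rw [← Complex.exp_add, ← Complex.exp_conj, dot_apply, cdot_apply]
  congr 1
  rw [Complex.ofReal_mul, h, ← Finset.sum_add_distrib, map_sum, Finset.mul_sum, Finset.sum_mul]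
  refine Finset.sum_congr rfl fun j _ => ?_
  simp
  ring

/-- The eigenfunctions are total. -/
theorem eq_zero_of_inner_landau {φ : GaussL2 n}
    (h : ∀ p s k, inner ℂ ((expGrowth_landau p s k).memLp.toLp (landau p s k)) φ = 0) :
    φ = 0 := by
  have hi : Integrable fun z => φ z * gaussian 1 z := by
    rw [← integrable_gaussMeasure_iff]
    simpa using (ExpGrowth.const (1 : ℂ)).integrable_mul_Lp φ
  have h0 := ae_eq_zero_of_fourier_eq_zero hi fun ξ => by
    have h1 := integral_conj_exp_eq_zero h (fun j => Real.pi * Complex.I * conj (ξ j))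
      (fun j => Real.pi * Complex.I * ξ j)
    rw [integral_gaussMeasure] at h1
    simp only [conj_exp_dot_mul_exp_cdot] at h1
    rw [Real.fourier_eq', ← h1]
    refine integral_congr_ae (Filter.Eventually.of_forall fun z => ?_)
    simp only [smul_eq_mul]
    ring
  rw [Lp.eq_zero_iff_ae_eq_zero]
  have hac : gaussMeasure n ≪ (volume : Measure (Cn n)) := withDensity_absolutelyContinuous _ _
  filter_upwards [hac.ae_le h0] with z hz
  refine (mul_eq_zero.mp hz).resolve_right ?_
  simp [gaussian, Complex.exp_ne_zero]

end Totality

/-! ### Spectral decomposition of the magnetic Laplacian -/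

section SpectralDecomposition

variable {n : ℕ}

/-- The span of the functions `landau p s k`. -/
def landauSpan (n : ℕ) : Submodule ℂ (GaussL2 n) :=
  Submodule.span ℂ (Set.range fun q : (Fin n → ℂ) × (Fin n → ℂ) × ℕ =>
    (expGrowth_landau q.1 q.2.1 q.2.2).memLp.toLp (landau q.1 q.2.1 q.2.2))

theorem landauSpan_topologicalClosure : (landauSpan n).topologicalClosure = ⊤ := by
  rw [Submodule.topologicalClosure_eq_top_iff, eq_bot_iff]
  intro φ hφ
  rw [Submodule.mem_bot]
  refine eq_zero_of_inner_landau fun p s k => ?_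
  exact (Submodule.mem_orthogonal _ _).mp hφ _ (Submodule.subset_span ⟨(p, s, k), rfl⟩)

theorem magneticLaplacian₀_dense : Dense ((magneticLaplacian₀ n).domain : Set (GaussL2 n)) := by
  rw [Submodule.dense_iff_topologicalClosure_eq_top, eq_top_iff, ← landauSpan_topologicalClosure]
  refine Submodule.topologicalClosure_minimal _ ?_ (Submodule.isClosed_topologicalClosure _)
  rw [landauSpan, Submodule.span_le]
  rintro _ ⟨⟨p, s, k⟩, rfl⟩
  obtain ⟨f, hf, -⟩ := exists_test_tendsto_landau p s k
  exact mem_closure_of_tendsto hf (Filter.Eventually.of_forall fun i => ⟨f i, rfl⟩)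

theorem magneticLaplacian₀_isClosable : (magneticLaplacian₀ n).IsClosable :=
  isClosable_of_symmetric magneticLaplacian₀_dense magneticLaplacian₀_isFormalAdjoint

theorem magneticLaplacian_isClosed : (magneticLaplacian n).IsClosed :=
  magneticLaplacian₀_isClosable.closure_isClosed

theorem magneticLaplacian_isFormalAdjoint :
    (magneticLaplacian n).IsFormalAdjoint (magneticLaplacian n) :=
  closure_isFormalAdjoint magneticLaplacian₀_isClosable magneticLaplacian₀_isFormalAdjoint

theorem landau_mem_eigen (p s : Fin n → ℂ) (k : ℕ) :
    (expGrowth_landau p s k).memLp.toLp (landau p s k) ∈ (magneticLaplacian n).eigen k := by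
  obtain ⟨f, hf, hf'⟩ := exists_test_tendsto_landau p s k
  exact mem_closure_graph_of_tendsto magneticLaplacian₀_isClosable
    (fun i => mem_graph_magneticLaplacian₀ (f i)) hf hf'

theorem magneticLaplacian_eigen_total :
    (⨆ k : ℕ, (magneticLaplacian n).eigen k).topologicalClosure = ⊤ := by
  rw [eq_top_iff, ← landauSpan_topologicalClosure]
  refine Submodule.topologicalClosure_mono ?_
  rw [landauSpan, Submodule.span_le]
  rintro _ ⟨⟨p, s, k⟩, rfl⟩
  exact Submodule.mem_iSup_of_mem k (landau_mem_eigen p s k)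

theorem magneticLaplacian_isSelfAdjoint : IsSelfAdjoint (magneticLaplacian n) :=
  isSelfAdjoint_of_eigen magneticLaplacian_isClosed magneticLaplacian_isFormalAdjoint
    magneticLaplacian_eigen_total

/-- The decomposition of `L²(ℂⁿ, e^{-|z|²} dν)` into Landau levels. -/
def landauLevels (n : ℕ) : HilbertDecomposition (GaussL2 n) :=
  eigenDecomposition (magneticLaplacian n) magneticLaplacian_isClosed
    magneticLaplacian_isFormalAdjoint magneticLaplacian_eigen_total

end SpectralDecomposition

/-! ### Gaussian moments -/

section Moments

variable {n : ℕ}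

theorem integral_gaussian_volume (τ : ℝ) (hτ : 0 < τ) :
    ∫ z, gaussian (n := n) τ z = ((Real.pi / τ) ^ n : ℝ) := by
  have h := GaussianFourier.integral_rexp_neg_mul_sq_norm (V := Cn n) hτ
  have hf : Module.finrank ℝ (Cn n) = 2 * n := by
    rw [← Module.finrank_mul_finrank ℝ ℂ (Cn n), Complex.finrank_real_complex,
      finrank_euclideanSpace_fin]
  simp only [gaussian]
  rw [integral_complex_ofReal]
  congr 1
  simp only [neg_mul] at h
  rw [h, hf]
  push_cast
  rw [mul_div_cancel_left₀ _ (two_ne_zero), Real.rpow_natCast]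

/-- The mean value property: integration by parts kills all terms `(a·u)^k` with `k ≥ 1` of the
exponential series. -/
theorem integral_exp_dot_mul_gaussian (a : Fin n → ℂ) {τ : ℝ} (hτ : 0 < τ) :
    ∫ u : Cn n, Complex.exp (dot a u) * gaussian τ u = ((Real.pi / τ) ^ n : ℝ) := by
  have hpow : ∀ k, ∫ u : Cn n, dot a u ^ (k + 1) * gaussian τ u = 0 := by
    intro k
    have hf : ExpGrowthC1 fun u : Cn n => dot a u ^ k := (ExpGrowthC1.clm (dot a)).pow k
    have h1 : ∀ j, ∫ u : Cn n, u j * dot a u ^ k * gaussian τ u = 0 := by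
      intro j
      have h := integral_dzbar_mul_gaussian hf hτ j
      have h0 : ∀ u, dzbar j (fun u : Cn n => dot a u ^ k) u = 0 := by
        intro u
        rw [dzbar_comp (hasDerivAt_pow k _) (dot a).differentiableAt]
        rw [show dzbar j (fun u => dot a u) u = 0 from dzbar_dot a j u, mul_zero]
      simp only [h0, zero_mul, integral_zero] at h
      exact (mul_eq_zero.mp h.symm).resolve_left (by exact_mod_cast hτ.ne')
    have h2 : ∀ u : Cn n, dot a u ^ (k + 1) * gaussian τ u
        = ∑ j, a j * (u j * dot a u ^ k * gaussian τ u) := by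
      intro u
      rw [pow_succ, dot_apply a u, Finset.mul_sum, Finset.sum_mul]
      exact Finset.sum_congr rfl fun j _ => by ring
    simp only [h2]
    rw [integral_finsetSum]
    · simp only [integral_const_mul, h1, mul_zero, Finset.sum_const_zero]
    · intro j _
      exact (((ExpGrowth.coord j).mul hf.2.1).integrable_mul_gaussian hτ).const_mul _
  let F : ℕ → Cn n → ℂ := fun k u => (k.factorial : ℂ)⁻¹ * (dot a u ^ k * gaussian τ u)
  have hF : ∀ k u, ‖F k u‖ = ‖dot a u‖ ^ k / k.factorial * ‖gaussian τ u‖ := by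
    intro k u
    simp only [F, norm_mul, norm_inv, Complex.norm_natCast, norm_pow]
    ring
  have hs1 : ∀ u, HasSum (fun k => ‖F k u‖) (Real.exp ‖dot a u‖ * ‖gaussian τ u‖) := by
    intro u
    simp only [hF]
    have := NormedSpace.expSeries_div_hasSum_exp (𝔸 := ℝ) ‖dot a u‖
    rw [← Real.exp_eq_exp_ℝ] at this
    exact this.mul_right _
  have hs2 : ∀ u, HasSum (fun k => F k u) (Complex.exp (dot a u) * gaussian τ u) := by
    intro u
    have h1 := NormedSpace.expSeries_div_hasSum_exp (𝔸 := ℂ) (dot a u)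
    rw [← Complex.exp_eq_exp_ℂ] at h1
    have h3 : ∀ k, F k u = dot a u ^ k / (k.factorial : ℂ) * gaussian τ u := by
      intro k
      simp only [F]
      ring
    simp only [h3]
    exact h1.mul_right _
  have hgr : ExpGrowth fun u : Cn n => ((Real.exp ‖dot a u‖ : ℝ) : ℂ) := by
    refine ⟨by fun_prop, 1, ‖dot a‖, zero_le_one, norm_nonneg _, fun u => ?_⟩
    rw [Complex.norm_real, Real.norm_of_nonneg (Real.exp_pos _).le, one_mul, Real.exp_le_exp]
    exact (dot a).le_opNorm u
  have hint : ∀ k, Integrable fun u : Cn n => dot a u ^ k * gaussian τ u := fun k =>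
    ((ExpGrowth.clm (dot a)).pow k).integrable_mul_gaussian hτ
  have key := hasSum_integral_of_dominated_convergence (μ := (volume : Measure (Cn n))) (F := F)
    (fun k u => ‖F k u‖) (fun k => ((hint k).const_mul _).aestronglyMeasurable)
    (fun k => Filter.Eventually.of_forall fun u => le_rfl)
    (Filter.Eventually.of_forall fun u => (hs1 u).summable)
    (by
      simp only [(hs1 _).tsum_eq]
      refine (hgr.integrable_mul_gaussian hτ).norm.congr (Filter.Eventually.of_forall fun u => ?_)
      simp only [norm_mul, Complex.norm_real, Real.norm_of_nonneg (Real.exp_pos _).le])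
    (Filter.Eventually.of_forall hs2)
  refine key.unique ?_
  rw [← integral_gaussian_volume (n := n) τ hτ]
  convert hasSum_single 0 ?_ using 1
  · simp [F]
  · intro k hk
    obtain ⟨k, rfl⟩ := Nat.exists_eq_succ_of_ne_zero hk
    rw [integral_const_mul, hpow, mul_zero]

theorem landau_succ (p s : Fin n → ℂ) (k : ℕ) (z : Cn n) :
    landau p s (k + 1) z = (cdot s z - ∑ j, s j * p j) * landau p s k z := by
  simp only [landau]
  ring

theorem expGrowthC1_norm_sq_pow_mul_landau (a s : Fin n → ℂ) (l k : ℕ) :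
    ExpGrowthC1 fun u : Cn n => ((‖u‖ ^ 2 : ℝ) : ℂ) ^ l * landau a s k u :=
  (ExpGrowthC1.norm_sq.pow l).mul (expGrowthC1_landau a s k)

/-- The natural number subtraction `k - 1` at `k = 0` is harmless, as the term has the factor `k`. -/
theorem sum_dzbar_conj_mul_landau (a s : Fin n → ℂ) (l k : ℕ) (u : Cn n) :
    ∑ j, dzbar j (fun u : Cn n => conj (u j) * (((‖u‖ ^ 2 : ℝ) : ℂ) ^ l * landau a s k u)) u
      = (n + l + k) * (((‖u‖ ^ 2 : ℝ) : ℂ) ^ l * landau a s k u)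
        + k * (∑ j, s j * a j) * (((‖u‖ ^ 2 : ℝ) : ℂ) ^ l * landau a s (k - 1) u) := by
  have d2 := (ExpGrowthC1.norm_sq (n := n)).1 u
  have h1 : ∀ j, dzbar j (fun u : Cn n => conj (u j) *
        (((‖u‖ ^ 2 : ℝ) : ℂ) ^ l * landau a s k u)) u
      = ((‖u‖ ^ 2 : ℝ) : ℂ) ^ l * landau a s k u
        + (conj (u j) * u j) * (l * ((‖u‖ ^ 2 : ℝ) : ℂ) ^ (l - 1) * landau a s k u)
        + (s j * conj (u j)) * (k * (((‖u‖ ^ 2 : ℝ) : ℂ) ^ l * landau a s (k - 1) u)) := by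
    intro j
    have h2 : dzbar j (fun u : Cn n => conj (u j)) u = 1 := by
      rw [conj_coord_eq_cdot, dzbar_cdot]
      simp
    rw [dzbar_mul ((ExpGrowthC1.conj_coord j).1 u)
        ((expGrowthC1_norm_sq_pow_mul_landau a s l k).1 u), h2,
      dzbar_mul (d2.fun_pow l) ((expGrowthC1_landau a s k).1 u),
      dzbar_comp (hasDerivAt_pow l _) d2, dzbar_norm_sq, dzbar_landau]
    ring
  simp only [h1]
  rw [Finset.sum_add_distrib, Finset.sum_add_distrib, Finset.sum_const, Finset.card_univ,
    Fintype.card_fin, nsmul_eq_mul, ← Finset.sum_mul, ← Finset.sum_mul, ← cdot_apply]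
  have h3 : ∑ j, conj (u j) * u j = ((‖u‖ ^ 2 : ℝ) : ℂ) := by
    rw [ofReal_norm_sq]
    exact Finset.sum_congr rfl fun j _ => mul_comm _ _
  have h4 : ((‖u‖ ^ 2 : ℝ) : ℂ) * (l * ((‖u‖ ^ 2 : ℝ) : ℂ) ^ (l - 1) * landau a s k u)
      = l * (((‖u‖ ^ 2 : ℝ) : ℂ) ^ l * landau a s k u) := by
    rcases l with _ | l
    · simp
    · rw [Nat.add_sub_cancel]
      ring
  have h5 : cdot s u * (k * (((‖u‖ ^ 2 : ℝ) : ℂ) ^ l * landau a s (k - 1) u))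
      = k * (((‖u‖ ^ 2 : ℝ) : ℂ) ^ l * landau a s k u)
        + k * (∑ j, s j * a j) * (((‖u‖ ^ 2 : ℝ) : ℂ) ^ l * landau a s (k - 1) u) := by
    rcases k with _ | k
    · simp
    · rw [Nat.add_sub_cancel, landau_succ]
      ring
  rw [h3, h4, h5]
  ring

/-- The moments `∫ |u|^{2l} e^{a·u} (s·(ū - a))^k e^{-2|u|²} dν(u)`. -/
def moment (a s : Fin n → ℂ) (l k : ℕ) : ℂ :=
  ∫ u : Cn n, ((‖u‖ ^ 2 : ℝ) : ℂ) ^ l * landau a s k u * gaussian 2 u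

theorem moment_zero_zero (a s : Fin n → ℂ) : moment a s 0 0 = ((Real.pi / 2) ^ n : ℝ) := by
  rw [← integral_exp_dot_mul_gaussian a two_pos, moment]
  simp [landau]

/-- Integration by parts in `z`, using that `landau a s k` is an eigenfunction of `∂/∂z_j`. -/
theorem moment_zero_succ (a s : Fin n → ℂ) (k : ℕ) :
    moment a s 0 (k + 1) = -(∑ j, s j * a j) / 2 * moment a s 0 k := by
  have hf := expGrowthC1_landau a s k
  have hi : ∀ j, Integrable fun u : Cn n => conj (u j) * landau a s k u * gaussian 2 u :=
    fun j => ((ExpGrowth.conj_coord j).mul hf.2.1).integrable_mul_gaussian two_pos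
  have hm : moment a s 0 k = ∫ u, landau a s k u * gaussian 2 u := by simp [moment]
  have h1 : ∀ j, a j * moment a s 0 k
      = 2 * ∫ u : Cn n, conj (u j) * landau a s k u * gaussian 2 u := by
    intro j
    have h := integral_dz_mul_gaussian hf two_pos j
    simp only [dz_landau, mul_assoc (a j)] at h
    rw [integral_const_mul, ← hm] at h
    exact_mod_cast h
  have h2 : ∀ u : Cn n, ((‖u‖ ^ 2 : ℝ) : ℂ) ^ 0 * landau a s (k + 1) u * gaussian 2 u
      = ∑ j, s j * (conj (u j) * landau a s k u * gaussian 2 u)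
        - (∑ j, s j * a j) * (landau a s k u * gaussian 2 u) := by
    intro u
    have h3 : ∑ j, s j * (conj (u j) * landau a s k u * gaussian 2 u)
        = cdot s u * (landau a s k u * gaussian 2 u) := by
      rw [cdot_apply, Finset.sum_mul]
      exact Finset.sum_congr rfl fun j _ => by ring
    rw [h3, landau_succ]
    ring
  rw [moment]
  simp only [h2]
  rw [integral_sub (integrable_finsetSum _ fun j _ => (hi j).const_mul _)
    ((hf.2.1.integrable_mul_gaussian two_pos).const_mul _),
    integral_finsetSum _ fun j _ => (hi j).const_mul _, integral_const_mul, ← hm]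
  simp only [integral_const_mul]
  have h4 : ∑ j, s j * ∫ u : Cn n, conj (u j) * landau a s k u * gaussian 2 u
      = (∑ j, s j * a j) / 2 * moment a s 0 k := by
    rw [Finset.sum_div, Finset.sum_mul]
    refine Finset.sum_congr rfl fun j _ => ?_
    linear_combination (-s j / 2) * h1 j
  rw [h4]
  ring

/-- Integration by parts in `z̄`, applied to `ū_j |u|^{2l} landau a s k` and summed over `j`. -/
theorem moment_succ (a s : Fin n → ℂ) (l k : ℕ) :
    moment a s (l + 1) k = ((n + l + k) * moment a s l k
      + k * (∑ j, s j * a j) * moment a s l (k - 1)) / 2 := by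
  have hf := expGrowthC1_norm_sq_pow_mul_landau a s l k
  have hi := fun k => (expGrowthC1_norm_sq_pow_mul_landau a s l k).2.1.integrable_mul_gaussian
    two_pos
  have hfj : ∀ j, ExpGrowthC1 fun u : Cn n =>
      conj (u j) * (((‖u‖ ^ 2 : ℝ) : ℂ) ^ l * landau a s k u) :=
    fun j => (ExpGrowthC1.conj_coord j).mul hf
  have h1 : ∑ j, ∫ u : Cn n, dzbar j (fun u : Cn n =>
          conj (u j) * (((‖u‖ ^ 2 : ℝ) : ℂ) ^ l * landau a s k u)) u * gaussian 2 u
      = 2 * ∑ j, ∫ u : Cn n,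
          u j * (conj (u j) * (((‖u‖ ^ 2 : ℝ) : ℂ) ^ l * landau a s k u)) * gaussian 2 u := by
    rw [Finset.mul_sum]
    refine Finset.sum_congr rfl fun j _ => ?_
    exact_mod_cast integral_dzbar_mul_gaussian (hfj j) two_pos j
  rw [← integral_finsetSum _ fun j _ => ((hfj j).dzbar j).integrable_mul_gaussian two_pos,
    ← integral_finsetSum _ fun j _ =>
      ((ExpGrowth.coord j).mul (hfj j).2.1).integrable_mul_gaussian two_pos] at h1
  simp only [← Finset.sum_mul, sum_dzbar_conj_mul_landau] at h1
  have h2 : ∀ u : Cn n, ∑ j, u j * (conj (u j) * (((‖u‖ ^ 2 : ℝ) : ℂ) ^ l * landau a s k u))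
      = ((‖u‖ ^ 2 : ℝ) : ℂ) ^ (l + 1) * landau a s k u := by
    intro u
    simp only [← mul_assoc, ← Finset.sum_mul]
    rw [← ofReal_norm_sq]
    ring
  have h3 : ∀ u : Cn n, ((n + l + k) * (((‖u‖ ^ 2 : ℝ) : ℂ) ^ l * landau a s k u)
        + k * (∑ j, s j * a j) * (((‖u‖ ^ 2 : ℝ) : ℂ) ^ l * landau a s (k - 1) u)) * gaussian 2 u
      = (n + l + k) * (((‖u‖ ^ 2 : ℝ) : ℂ) ^ l * landau a s k u * gaussian 2 u)
        + k * (∑ j, s j * a j)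
          * (((‖u‖ ^ 2 : ℝ) : ℂ) ^ l * landau a s (k - 1) u * gaussian 2 u) := fun u => by ring
  simp only [h2, h3] at h1
  rw [integral_add ((hi k).const_mul _) ((hi (k - 1)).const_mul _), integral_const_mul,
    integral_const_mul] at h1
  simp only [moment]
  linear_combination (-1 / 2) * h1

/-- The sums `∑_j C(k, j) (-1/2)^j (n + j)_l`. -/
def pochSum (n l k : ℕ) : ℝ :=
  ∑ j ∈ Finset.range (k + 1), (k.choose j : ℝ) * (-1 / 2) ^ j * poch (n + j) l

theorem poch_succ (n l : ℕ) : poch n (l + 1) = poch n l * (n + l) :=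
  ascPochhammer_succ_eval l (n : ℝ)

theorem pochSum_zero (n k : ℕ) : pochSum n 0 k = (1 / 2) ^ k := by
  have h := add_pow (-1 / 2 : ℝ) 1 k
  rw [show (-1 / 2 : ℝ) + 1 = 1 / 2 by norm_num] at h
  rw [h, pochSum]
  refine Finset.sum_congr rfl fun j _ => ?_
  simp [poch]
  ring

theorem pochSum_succ (n l k : ℕ) :
    pochSum n (l + 1) k = (n + l + k) * pochSum n l k - k * pochSum n l (k - 1) := by
  rcases k with _ | k
  · simp [pochSum, poch_succ]
    ring
  have h0 : pochSum n l k
      = ∑ j ∈ Finset.range (k + 2), (k.choose j : ℝ) * (-1 / 2) ^ j * poch (n + j) l := by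
    rw [Finset.sum_range_succ, Nat.choose_succ_self, pochSum]
    simp
  rw [Nat.add_sub_cancel, h0, pochSum, pochSum, Finset.mul_sum, Finset.mul_sum,
    ← Finset.sum_sub_distrib]
  refine Finset.sum_congr rfl fun j hj => ?_
  have hj' : j ≤ k + 1 := Nat.lt_succ_iff.mp (Finset.mem_range.mp hj)
  -- `(k + 1) C(k, j) = C(k + 1, j) (k + 1 - j)`
  have h1 : ((k : ℝ) + 1) * (k.choose j : ℝ) = ((k + 1).choose j : ℝ) * (k + 1 - j) := by
    have h : ((k.choose j * (k + 1) : ℕ) : ℝ) = (((k + 1).choose j * (k + 1 - j) : ℕ) : ℝ) :=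
      congrArg _ (Nat.choose_mul_succ_eq k j)
    rw [Nat.cast_mul, Nat.cast_mul, Nat.cast_sub hj'] at h
    push_cast at h
    linarith
  rw [poch_succ]
  push_cast
  linear_combination (-1 / 2) ^ j * poch (n + j) l * h1

theorem moment_eq (a s : Fin n → ℂ) (l k : ℕ) :
    moment a s l k = (((Real.pi / 2) ^ n * (1 / 2) ^ l * pochSum n l k : ℝ) : ℂ)
      * (-∑ j, s j * a j) ^ k := by
  induction l generalizing k with
  | zero =>
    rw [pochSum_zero]
    induction k with
    | zero => simp [moment_zero_zero]
    | succ k ih =>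
      rw [moment_zero_succ, ih]
      push_cast
      ring
  | succ l ih =>
    rw [moment_succ, ih, ih, pochSum_succ]
    rcases k with _ | k
    · push_cast
      ring
    · rw [Nat.add_sub_cancel]
      push_cast
      ring

end Moments

/-! ### The elementary kernels -/

section Kernel

variable {n : ℕ}

/-- The kernel `e^{⟨z,w⟩} |z - w|^{2l} e^{-|z - w|²}`. -/
def radialKernel (l : ℕ) (z w : Cn n) : ℂ :=
  Complex.exp (cdot (fun j => z j) w) * (((‖z - w‖ ^ 2 : ℝ) : ℂ) ^ l * gaussian 1 (z - w))

theorem cdot_eq_inner (z w : Cn n) : cdot (fun j => z j) w = inner ℂ w z := by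
  simp [cdot_apply, PiLp.inner_apply]

theorem ExpGrowth.const_sub {f : Cn n → ℂ} (hf : ExpGrowth f) (z : Cn n) :
    ExpGrowth fun w => f (z - w) := by
  obtain ⟨h, C, c, hC, hc, hb⟩ := hf
  refine ⟨h.comp (by fun_prop), C * Real.exp (c * ‖z‖), c, by positivity, hc, fun w => ?_⟩
  refine (hb _).trans ?_
  rw [mul_assoc, ← Real.exp_add, ← mul_add]
  gcongr
  exact norm_sub_le z w

theorem expGrowth_radialKernel (l : ℕ) (z : Cn n) : ExpGrowth (radialKernel l z) := by
  have hg : ExpGrowth (gaussian (n := n) 1) := by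
    refine .of_bounded (contDiff_gaussian 1).continuous (C := 1) fun z => ?_
    rw [gaussian, Complex.norm_real, Real.norm_of_nonneg (Real.exp_pos _).le,
      Real.exp_le_one_iff]
    have : 0 ≤ ‖z‖ ^ 2 := by positivity
    linarith
  exact (ExpGrowth.cexp_clm _).mul (((ExpGrowth.norm_sq.pow l).mul hg).const_sub z)

/-- The integral operator with kernel `radialKernel l`. -/
def radialOp (l : ℕ) (φ : Cn n → ℂ) (z : Cn n) : ℂ :=
  ∫ w, radialKernel l z w * φ w ∂gaussMeasure n

/-- Completing the square: with `w = z + u`, the weights `e^{⟨z,w⟩ - |z-w|² - |w|²}` and the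
eigenfunction at `w` combine to an eigenfunction at `u` times `e^{-2|u|²}`. -/
theorem radialKernel_mul_landau (l : ℕ) (p s : Fin n → ℂ) (k : ℕ) (z u : Cn n) :
    radialKernel l z (z + u) * landau p s k (z + u) * gaussian 1 (z + u)
      = Complex.exp (dot p z) * (((‖u‖ ^ 2 : ℝ) : ℂ) ^ l
        * landau (fun j => p j - conj (z j)) s k u * gaussian 2 u) := by
  have h1 : z - (z + u) = -u := by abel
  have h2 : cdot s (z + u) - ∑ j, s j * p j
      = cdot s u - ∑ j, s j * (p j - conj (z j)) := by
    simp only [mul_sub, Finset.sum_sub_distrib, map_add, cdot_apply]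
    ring
  have h3 : Complex.exp (cdot (fun j => z j) (z + u)) * gaussian 1 (-u)
      * Complex.exp (dot p (z + u)) * gaussian 1 (z + u)
      = Complex.exp (dot p z) * (Complex.exp (dot (fun j => p j - conj (z j)) u)
        * gaussian 2 u) := by
    simp only [gaussian_eq_cexp, ← Complex.exp_add]
    congr 1
    simp only [ofReal_norm_sq, dot_apply, cdot_apply, PiLp.add_apply, PiLp.neg_apply,
      Finset.mul_sum, ← Finset.sum_add_distrib]
    refine Finset.sum_congr rfl fun j _ => ?_
    simp only [map_add, map_neg]
    push_cast
    ring
  simp only [radialKernel, landau, h1, h2, norm_neg]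
  linear_combination (((‖u‖ ^ 2 : ℝ) : ℂ) ^ l
    * (cdot s u - ∑ j, s j * (p j - conj (z j))) ^ k) * h3

/-- `radialOp l` acts on the `k`-th Landau level as a scalar. -/
theorem radialOp_landau (l : ℕ) (p s : Fin n → ℂ) (k : ℕ) (z : Cn n) :
    radialOp l (landau p s k) z
      = (((Real.pi / 2) ^ n * (1 / 2) ^ l * pochSum n l k : ℝ) : ℂ) * landau p s k z := by
  rw [radialOp, integral_gaussMeasure,
    ← integral_add_left_eq_self (fun w => radialKernel l z w * landau p s k w * gaussian 1 w) z]
  simp only [radialKernel_mul_landau]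
  rw [integral_const_mul]
  have h := moment_eq (fun j => p j - conj (z j)) s l k
  rw [moment] at h
  have h2 : -∑ j, s j * (p j - conj (z j)) = cdot s z - ∑ j, s j * p j := by
    simp only [mul_sub, Finset.sum_sub_distrib, cdot_apply]
    ring
  rw [h, h2, landau]
  ring

theorem radialOp_congr (l : ℕ) {φ ψ : Cn n → ℂ} (h : φ =ᵐ[gaussMeasure n] ψ) :
    radialOp l φ = radialOp l ψ := by
  ext z
  refine integral_congr_ae ?_
  filter_upwards [h] with w hw
  rw [hw]

theorem radialOp_eq_inner (l : ℕ) (φ : GaussL2 n) (z : Cn n) :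
    radialOp l φ z = inner ℂ ((expGrowth_radialKernel l z).star.memLp.toLp _) φ := by
  rw [inner_toLp_left]
  simp only [Complex.conj_conj]
  rfl

/-- A bounded operator that multiplies the `k`-th Landau level by the scalar by which `radialOp l`
acts on its eigenfunctions agrees with `radialOp l`. -/
theorem radialOp_ae_eq (l : ℕ) (T : GaussL2 n →L[ℂ] GaussL2 n)
    (hT : ∀ k : ℕ, ∀ x ∈ (magneticLaplacian n).eigen k,
      T x = (((Real.pi / 2) ^ n * (1 / 2) ^ l * pochSum n l k : ℝ) : ℂ) • x) (φ : GaussL2 n) :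
    radialOp l φ =ᵐ[gaussMeasure n] T φ := by
  -- the identity holds on the span of the eigenfunctions
  have hspan : ∀ ψ ∈ landauSpan n, radialOp l ψ =ᵐ[gaussMeasure n] T ψ := by
    intro ψ hψ
    induction hψ using Submodule.span_induction with
    | mem ψ h =>
      obtain ⟨⟨p, s, k⟩, rfl⟩ := h
      have hL := (expGrowth_landau p s k).memLp
      simp only
      rw [hT k _ (landau_mem_eigen p s k), radialOp_congr l hL.coeFn_toLp]
      filter_upwards [Lp.coeFn_smul (((Real.pi / 2) ^ n * (1 / 2) ^ l * pochSum n l k : ℝ) : ℂ)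
        (hL.toLp (landau p s k)), hL.coeFn_toLp] with z h1 h2
      rw [h1, Pi.smul_apply, h2, radialOp_landau, smul_eq_mul]
    | zero =>
      rw [map_zero]
      filter_upwards [Lp.coeFn_zero ℂ 2 (gaussMeasure n)] with z hz
      rw [radialOp_eq_inner, inner_zero_right, hz]
      rfl
    | add x y _ _ hx hy =>
      rw [map_add]
      filter_upwards [hx, hy, Lp.coeFn_add (T x) (T y)] with z h1 h2 h3
      rw [h3, Pi.add_apply, ← h1, ← h2]
      simp only [radialOp_eq_inner, inner_add_right]
    | smul c x _ hx =>
      rw [map_smul]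
      filter_upwards [hx, Lp.coeFn_smul c (T x)] with z h1 h2
      rw [h2, Pi.smul_apply, ← h1]
      simp only [radialOp_eq_inner, inner_smul_right, smul_eq_mul]
  -- both sides are continuous in `φ`: pointwise in `z`, and in `L²`
  have hφ : φ ∈ closure (landauSpan n : Set (GaussL2 n)) := by
    have : φ ∈ (landauSpan n).topologicalClosure := by
      rw [landauSpan_topologicalClosure]
      trivial
    exact this
  obtain ⟨ψ, hψ, hlim⟩ := mem_closure_iff_seq_limit.mp hφ
  have hTl : Filter.Tendsto (fun i => T (ψ i)) Filter.atTop (nhds (T φ)) :=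
    (T.continuous.tendsto φ).comp hlim
  obtain ⟨ns, hns, hae⟩ := (tendstoInMeasure_of_tendsto_Lp hTl).exists_seq_tendsto_ae
  have hall : ∀ᵐ z ∂gaussMeasure n, ∀ i, radialOp l (ψ i) z = T (ψ i) z :=
    ae_all_iff.mpr fun i => hspan _ (hψ i)
  filter_upwards [hae, hall] with z h1 h2
  have h3 : Filter.Tendsto (fun i => radialOp l (ψ (ns i)) z) Filter.atTop
      (nhds (radialOp l φ z)) := by
    simp only [radialOp_eq_inner]
    exact (tendsto_const_nhds.inner (hlim.comp hns.tendsto_atTop))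
  simp only [h2] at h3
  exact tendsto_nhds_unique h3 h1

end Kernel

/-! ### Expansion of the Berezin kernel -/

section Expansion

variable {n : ℕ}

theorem binom_sub (n m i : ℕ) (hi : i ≤ m) : binom n ((m : ℤ) - i) = (n.choose (m - i) : ℝ) := by
  rw [binom, if_pos (by omega), ← Nat.cast_sub hi, Int.toNat_natCast]

theorem binom_sub_of_lt (n m i : ℕ) (hi : m < i) : binom n ((m : ℤ) - i) = 0 := by
  rw [binom, if_neg (by omega)]

theorem laguerreL_sq (n m : ℕ) (hn : 1 ≤ n) (x : ℝ) :
    laguerreL m (n - 1) x ^ 2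
      = ∑ l ∈ Finset.range (2 * m + 1), sigmaCoeff n m l * x ^ l / (l.factorial : ℝ) := by
  let f : ℕ → ℝ := fun i =>
    (-1) ^ i * binom (n + m - 1) ((m : ℤ) - i) * x ^ i / (i.factorial : ℝ)
  have hf0 : ∀ i, m < i → f i = 0 := fun i hi => by simp [f, binom_sub_of_lt _ _ _ hi]
  have hL : laguerreL m (n - 1) x = ∑ i ∈ Finset.range (m + 1), f i := by
    refine Finset.sum_congr rfl fun i hi => ?_
    have hi' : i ≤ m := Nat.lt_succ_iff.mp (Finset.mem_range.mp hi)
    simp only [f]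
    rw [binom_sub _ _ _ hi', show m + (n - 1) = n + m - 1 by omega]
  have hprod : laguerreL m (n - 1) x ^ 2
      = ∑ l ∈ Finset.range (2 * m + 1), ∑ q ∈ Finset.HasAntidiagonal.antidiagonal l, f q.1 * f q.2 := by
    rw [hL, sq, Finset.sum_mul_sum, ← Finset.sum_product',
      ← Finset.sum_fiberwise_of_maps_to (t := Finset.range (2 * m + 1)) (g := fun q => q.1 + q.2)]
    · refine Finset.sum_congr rfl fun l _ => Finset.sum_subset (fun q hq => ?_) fun q hq hq' => ?_
      · exact Finset.HasAntidiagonal.mem_antidiagonal.mpr (Finset.mem_filter.mp hq).2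
      · rw [Finset.HasAntidiagonal.mem_antidiagonal] at hq
        simp only [Finset.mem_filter, Finset.mem_product, Finset.mem_range, not_and'] at hq'
        have := hq' hq
        rcases lt_or_ge m q.1 with h | h
        · rw [hf0 _ h, zero_mul]
        · rw [hf0 q.2 (by omega), mul_zero]
    · intro q hq
      simp only [Finset.mem_product, Finset.mem_range] at hq ⊢
      omega
  rw [hprod]
  refine Finset.sum_congr rfl fun l _ => ?_
  rw [Finset.Nat.sum_antidiagonal_eq_sum_range_succ (fun i j => f i * f j), sigmaCoeff,
    Finset.mul_sum, Finset.sum_mul, Finset.sum_div]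
  refine Finset.sum_congr rfl fun i hi => ?_
  have hi' : i ≤ l := Nat.lt_succ_iff.mp (Finset.mem_range.mp hi)
  have hfac : (l.factorial : ℝ) = l.choose i * i.factorial * (l - i).factorial := by
    exact_mod_cast (Nat.choose_mul_factorial_mul_factorial hi').symm
  have hsub : ((m : ℤ) - ((l - i : ℕ) : ℤ)) = (m : ℤ) - l + i := by
    rw [Nat.cast_sub hi']
    ring
  have hchoose : (l.choose i : ℝ) ≠ 0 := by exact_mod_cast (Nat.choose_pos hi').ne'
  have hx : x ^ i * x ^ (l - i) = x ^ l := by rw [← pow_add, Nat.add_sub_cancel' hi']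
  have hs : ((-1 : ℝ)) ^ i * (-1) ^ (l - i) = (-1) ^ l := by
    rw [← pow_add, Nat.add_sub_cancel' hi']
  simp only [f, hsub]
  rw [hfac, ← hx, ← hs]
  have h1 : (i.factorial : ℝ) ≠ 0 := by positivity
  have h2 : ((l - i).factorial : ℝ) ≠ 0 := by positivity
  field_simp

theorem poch_eq_ascFactorial (n l : ℕ) : poch n l = (n.ascFactorial l : ℝ) :=
  (Nat.cast_ascFactorial ℝ n l).symm

theorem laguerreL_zero (n m : ℕ) (hn : 1 ≤ n) :
    laguerreL m (n - 1) 0 = poch n m / (m.factorial : ℝ) := by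
  rw [laguerreL, Finset.sum_eq_single 0]
  · have h : (poch n m : ℝ) = m.factorial * ((m + (n - 1)).choose m : ℝ) := by
      have h1 : n.ascFactorial m = m.factorial * (n + m - 1).choose m :=
        Nat.ascFactorial_eq_factorial_mul_choose' n m
      rw [poch_eq_ascFactorial, h1, show m + (n - 1) = n + m - 1 by omega]
      push_cast
      ring
    rw [h]
    have : (m.factorial : ℝ) ≠ 0 := by positivity
    field_simp
    simp
  · intro j _ hj
    simp [hj]
  · simp

theorem poch_pos {n : ℕ} (hn : 1 ≤ n) (m : ℕ) : 0 < poch n m :=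
  ascPochhammer_pos m (n : ℝ) (by exact_mod_cast hn)

/-- The Berezin kernel in terms of the elementary kernels. -/
theorem berezinIntegrand_eq (n m : ℕ) (hn : 1 ≤ n) (φ : Cn n → ℂ) (z w : Cn n) :
    berezinIntegrand n m φ z w
      = ((((m.factorial : ℝ) / poch n m) ^ 2 : ℝ) : ℂ) * ∑ l ∈ Finset.range (2 * m + 1),
        ((sigmaCoeff n m l / (l.factorial : ℝ) : ℝ) : ℂ) *
          (radialKernel l z w * φ w * gaussian 1 w) := by
  have hp := (poch_pos hn m).ne'
  have hm : (m.factorial : ℝ) ≠ 0 := by positivity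
  have hK : ∀ z : Cn n, reproKernel n m z z
      = ((1 / Real.pi ^ n * Real.exp (‖z‖ ^ 2) * (poch n m / m.factorial) : ℝ) : ℂ) := by
    intro z
    rw [reproKernel, sub_self, norm_zero, zero_pow two_ne_zero, laguerreL_zero n m hn,
      inner_self_eq_norm_sq_to_K]
    push_cast
    rfl
  have hN : ‖reproKernel n m z w‖ ^ 2
      = (1 / Real.pi ^ n) ^ 2 * (Real.exp (‖z‖ ^ 2) * Real.exp (‖w‖ ^ 2)
          * Real.exp (-‖z - w‖ ^ 2)) * laguerreL m (n - 1) (‖z - w‖ ^ 2) ^ 2 := by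
    have h1 : ‖Complex.exp (inner ℂ w z)‖ ^ 2
        = Real.exp (‖z‖ ^ 2) * Real.exp (‖w‖ ^ 2) * Real.exp (-‖z - w‖ ^ 2) := by
      rw [Complex.norm_exp, ← Real.exp_nat_mul, ← Real.exp_add, ← Real.exp_add]
      congr 1
      have h2 := norm_sub_sq (𝕜 := ℂ) w z
      rw [norm_sub_rev z w, h2]
      simp only [Nat.cast_ofNat, RCLike.re_eq_complex_re]
      ring
    rw [reproKernel, norm_mul, norm_mul, mul_pow, mul_pow, h1, Complex.norm_real,
      ← sq_abs (laguerreL _ _ _)]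
    congr 2
    simp [abs_of_pos Real.pi_pos]
  have hreal : ‖reproKernel n m z w‖ ^ 2 / ((1 / Real.pi ^ n * Real.exp (‖z‖ ^ 2)
        * (poch n m / m.factorial)) * (1 / Real.pi ^ n * Real.exp (‖w‖ ^ 2)
        * (poch n m / m.factorial)))
      = ((m.factorial : ℝ) / poch n m) ^ 2 * (Real.exp (-‖z - w‖ ^ 2)
        * ∑ l ∈ Finset.range (2 * m + 1), sigmaCoeff n m l * (‖z - w‖ ^ 2) ^ l / l.factorial) := by
    rw [hN, ← laguerreL_sq n m hn]
    have := Real.pi_ne_zero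
    have e1 := (Real.exp_pos (‖z‖ ^ 2)).ne'
    have e2 := (Real.exp_pos (‖w‖ ^ 2)).ne'
    field_simp
  rw [berezinIntegrand, hK, hK, ← Complex.ofReal_mul, ← Complex.ofReal_div, hreal]
  simp only [radialKernel, cdot_eq_inner, gaussian, one_mul]
  push_cast
  simp only [Finset.mul_sum, Finset.sum_mul]
  refine Finset.sum_congr rfl fun l _ => ?_
  ring

theorem integrable_radialKernel_mul (l : ℕ) (φ : GaussL2 n) (z : Cn n) :
    Integrable fun w => radialKernel l z w * φ w * gaussian 1 w :=
  integrable_gaussMeasure_iff.mp ((expGrowth_radialKernel l z).integrable_mul_Lp φ)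

theorem integrable_berezinIntegrand (n m : ℕ) (hn : 1 ≤ n) (φ : GaussL2 n) (z : Cn n) :
    Integrable (berezinIntegrand n m φ z) := by
  rw [show berezinIntegrand n m φ z = _ from funext fun w => berezinIntegrand_eq n m hn φ z w]
  exact (integrable_finsetSum _ fun l _ =>
    (integrable_radialKernel_mul l φ z).const_mul _).const_mul _

theorem phaseBerezin_eq (n m : ℕ) (hn : 1 ≤ n) (φ : GaussL2 n) (z : Cn n) :
    phaseBerezin n m φ z = ((((m.factorial : ℝ) / poch n m) ^ 2 : ℝ) : ℂ) *
      ∑ l ∈ Finset.range (2 * m + 1),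
        ((sigmaCoeff n m l / (l.factorial : ℝ) : ℝ) : ℂ) * radialOp l φ z := by
  rw [phaseBerezin]
  simp only [berezinIntegrand_eq n m hn]
  rw [integral_const_mul,
    integral_finsetSum _ fun l _ => (integrable_radialKernel_mul l φ z).const_mul _]
  simp only [integral_const_mul, radialOp, integral_gaussMeasure]

end Expansion

/-! ### Hypergeometric values -/

section Hypergeometric

theorem ascPochhammer_eval_neg_natCast (k j : ℕ) :
    (ascPochhammer ℝ j).eval (-(k : ℝ)) = (-1) ^ j * (j.factorial * k.choose j : ℝ) := by
  rw [ascPochhammer_eval_neg_eq_descPochhammer, descPochhammer_eval_eq_descFactorial,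
    Nat.descFactorial_eq_factorial_mul_choose]
  push_cast
  ring

theorem poch_add (n l j : ℕ) : poch n (l + j) = poch n l * poch (n + l) j := by
  simp only [poch_eq_ascFactorial]
  exact_mod_cast (Nat.ascFactorial_mul_ascFactorial n l j).symm

/-- `(n)_l ₂F₁(-k, n + l; n; 1/2)` is a finite sum. -/
theorem poch_mul_hypergeometric {n : ℕ} (hn : 1 ≤ n) (l k : ℕ) :
    poch n l * ₂F₁ (-(k : ℝ)) ((n : ℝ) + l) (n : ℝ) (1 / 2 : ℝ) = pochSum n l k := by
  rw [ordinaryHypergeometric_eq_tsum]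
  simp only
  rw [tsum_eq_sum (s := Finset.range (k + 1)), pochSum, Finset.mul_sum]
  · refine Finset.sum_congr rfl fun j _ => ?_
    have h1 : (ascPochhammer ℝ j).eval ((n : ℝ) + l) = poch (n + l) j := by simp [poch]
    have h2 : (ascPochhammer ℝ j).eval (n : ℝ) = poch n j := rfl
    have h3 : poch n l * poch (n + l) j = poch n j * poch (n + j) l := by
      rw [← poch_add, ← poch_add, add_comm]
    have h4 := (poch_pos hn j).ne'
    have h5 : (j.factorial : ℝ) ≠ 0 := by positivity
    rw [ascPochhammer_eval_neg_natCast, h1, h2, smul_eq_mul]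
    have h6 : (-1 / 2 : ℝ) ^ j = (-1) ^ j * (1 / 2) ^ j := by
      rw [← mul_pow]
      norm_num
    rw [h6]
    field_simp
    linear_combination (k.choose j : ℝ) * h3
  · intro j hj
    rw [Finset.mem_range, not_lt] at hj
    rw [ascPochhammer_eval_neg_natCast, Nat.choose_eq_zero_of_lt (by omega)]
    simp

/-- The exponential decay in `k` propagates from `l = 0` through the recursion in `l`. -/
theorem exists_abs_pochSum_le (n l : ℕ) :
    ∃ C : ℝ, 0 ≤ C ∧ ∀ k, |pochSum n l k| ≤ C * ((k : ℝ) + 1) ^ l * (1 / 2) ^ k := by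
  induction l with
  | zero => 
    refine ⟨1, zero_le_one, fun k => ?_⟩
    rw [pochSum_zero, abs_of_nonneg (by positivity)]
    simp
  | succ l ih =>
    obtain ⟨C, hC, h⟩ := ih
    refine ⟨C * (n + l + 3), by positivity, fun k => ?_⟩
    have hk0 : (0 : ℝ) ≤ k := by positivity
    rw [pochSum_succ]
    have h1 : |((n : ℝ) + l + k) * pochSum n l k|
        ≤ (n + l + 1) * (k + 1) * (C * ((k : ℝ) + 1) ^ l * (1 / 2) ^ k) := by
      rw [abs_mul, abs_of_nonneg (by positivity)]
      refine mul_le_mul ?_ (h k) (abs_nonneg _) (by positivity)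
      nlinarith [(by positivity : (0 : ℝ) ≤ (n : ℝ) * k), (by positivity : (0 : ℝ) ≤ (l : ℝ) * k)]
    have h2 : |(k : ℝ) * pochSum n l (k - 1)|
        ≤ 2 * (k + 1) * (C * ((k : ℝ) + 1) ^ l * (1 / 2) ^ k) := by
      rcases k with _ | k
      · simp
        positivity
      · rw [abs_mul, abs_of_nonneg (by positivity), Nat.add_sub_cancel]
        have h3 : C * ((k : ℝ) + 1) ^ l * (1 / 2) ^ k
            ≤ 2 * (C * (((k + 1 : ℕ) : ℝ) + 1) ^ l * (1 / 2) ^ (k + 1)) := by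
          rw [pow_succ (1 / 2 : ℝ) k]
          have : ((k : ℝ) + 1) ^ l ≤ (((k + 1 : ℕ) : ℝ) + 1) ^ l := by
            gcongr
            linarith [Nat.cast_succ (R := ℝ) k]
          have h4 := mul_le_mul_of_nonneg_left this
            (mul_nonneg hC (by positivity : (0 : ℝ) ≤ (1 / 2) ^ k))
          linarith
        calc ((k + 1 : ℕ) : ℝ) * |pochSum n l k|
            ≤ (((k + 1 : ℕ) : ℝ) + 1) *
              (2 * (C * (((k + 1 : ℕ) : ℝ) + 1) ^ l * (1 / 2) ^ (k + 1))) :=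
              mul_le_mul (by linarith) ((h k).trans h3) (abs_nonneg _) (by positivity)
          _ = _ := by ring
    refine (abs_sub _ _).trans ((add_le_add h1 h2).trans_eq ?_)
    ring

theorem exists_abs_hypergeometric_le {n : ℕ} (hn : 1 ≤ n) (l : ℕ) :
    ∃ C : ℝ, ∀ k : ℕ, |₂F₁ (-(k : ℝ)) ((n : ℝ) + l) (n : ℝ) (1 / 2 : ℝ)| ≤ C := by
  obtain ⟨C, hC, h⟩ := exists_abs_pochSum_le n l
  have ht := tendsto_pow_const_div_const_pow_of_one_lt l (one_lt_two : (1 : ℝ) < 2)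
  obtain ⟨B, hB⟩ := ht.bddAbove_range
  refine ⟨(poch n l)⁻¹ * (C * (2 * B)), fun k => ?_⟩
  have hp := poch_pos hn l
  rw [← mul_le_mul_iff_right₀ hp, ← mul_assoc, mul_inv_cancel₀ hp.ne', one_mul]
  nth_rw 1 [← abs_of_pos hp]
  rw [← abs_mul, poch_mul_hypergeometric hn]
  refine (h k).trans ?_
  rw [mul_assoc]
  refine mul_le_mul_of_nonneg_left ?_ hC
  have h1 : (((k + 1 : ℕ) : ℝ)) ^ l / 2 ^ (k + 1) ≤ B := hB ⟨k + 1, rfl⟩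
  have h2 : ((k : ℝ) + 1) ^ l * (1 / 2) ^ k = 2 * ((((k + 1 : ℕ) : ℝ)) ^ l / 2 ^ (k + 1)) := by
    push_cast
    rw [pow_succ (2 : ℝ), one_div, inv_pow]
    field_simp
  rw [h2]
  linarith

theorem Gamma_natCast_add {n : ℕ} (hn : 1 ≤ n) (l : ℕ) :
    Real.Gamma ((n : ℝ) + l) = Real.Gamma n * poch n l := by
  induction l with
  | zero => simp [poch]
  | succ l ih =>
    have h : ((n : ℝ) + l) ≠ 0 := by positivity
    rw [poch_succ, Nat.cast_succ, ← add_assoc, Real.Gamma_add_one h, ih]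
    ring

end Hypergeometric

end

theorem theorem3p3 (n m : ℕ) (hn : 1 ≤ n) :
    IsSelfAdjoint (magneticLaplacian n) ∧
    ∃ F : ℕ → GaussL2 n →L[ℂ] GaussL2 n,
      (∀ l ∈ Finset.range (2 * m + 1),
        IsFunctionOf (magneticLaplacian n)
          (fun t : ℝ => ((₂F₁ (-t) ((n : ℝ) + l) (n : ℝ) (1 / 2 : ℝ) : ℝ) : ℂ)) (F l)) ∧
      ∀ φ : GaussL2 n,
        (∀ z : Cn n, MeasureTheory.Integrable (berezinIntegrand n m φ z)) ∧
        phaseBerezin n m φ =ᵐ[gaussMeasure n]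
          ((((2 : ℝ)⁻¹ ^ n * Real.pi ^ n / Real.Gamma n * ((m.factorial : ℝ) / poch n m) ^ 2 : ℝ) : ℂ) •
            ∑ l ∈ Finset.range (2 * m + 1),
              (((2 : ℝ)⁻¹ ^ l * sigmaCoeff n m l * Real.Gamma ((n : ℝ) + l) / (l.factorial : ℝ)
                : ℝ) : ℂ) • F l φ : GaussL2 n) := by
  choose C hC using fun l => exists_abs_hypergeometric_le hn l
  have hC' : ∀ l k : ℕ,
      ‖((₂F₁ (-(k : ℝ)) ((n : ℝ) + l) (n : ℝ) (1 / 2 : ℝ) : ℝ) : ℂ)‖ ≤ C l := fun l k => by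
    rw [Complex.norm_real]
    exact hC l k
  let F : ℕ → GaussL2 n →L[ℂ] GaussL2 n := fun l =>
    (landauLevels n).diag
      (fun k => ((₂F₁ (-(k : ℝ)) ((n : ℝ) + l) (n : ℝ) (1 / 2 : ℝ) : ℝ) : ℂ)) (C l) (hC' l)
  refine ⟨magneticLaplacian_isSelfAdjoint, F, fun l _ => isFunctionOf_diag _ _ _ (hC' l),
    fun φ => ⟨integrable_berezinIntegrand n m hn φ, ?_⟩⟩
  have hG : Real.Gamma n ≠ 0 := (Real.Gamma_pos_of_pos (by exact_mod_cast hn)).ne'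
  have hop : ∀ l, radialOp l φ =ᵐ[gaussMeasure n]
      ((((Real.pi / 2) ^ n * (1 / 2) ^ l * poch n l : ℝ) : ℂ) • F l) φ := fun l => by
    refine radialOp_ae_eq l _ (fun k x hx => ?_) φ
    rw [smul_apply, (landauLevels n).diag_of_mem (hC' l) hx, smul_smul,
      ← poch_mul_hypergeometric hn]
    push_cast
    ring_nf
  have hsum : ((((2 : ℝ)⁻¹ ^ n * Real.pi ^ n / Real.Gamma n
        * ((m.factorial : ℝ) / poch n m) ^ 2 : ℝ) : ℂ) •
      ∑ l ∈ Finset.range (2 * m + 1),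
        (((2 : ℝ)⁻¹ ^ l * sigmaCoeff n m l * Real.Gamma ((n : ℝ) + l) / (l.factorial : ℝ)
          : ℝ) : ℂ) • F l φ : GaussL2 n)
      = ((((m.factorial : ℝ) / poch n m) ^ 2 : ℝ) : ℂ) • ∑ l ∈ Finset.range (2 * m + 1),
        ((sigmaCoeff n m l / (l.factorial : ℝ) : ℝ) : ℂ) •
          ((((Real.pi / 2) ^ n * (1 / 2) ^ l * poch n l : ℝ) : ℂ) • F l) φ := by
    simp only [Finset.smul_sum, smul_apply, smul_smul, ← Complex.ofReal_mul]
    refine Finset.sum_congr rfl fun l _ => ?_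
    congr 2
    rw [Gamma_natCast_add hn]
    simp only [div_pow, one_div, inv_pow]
    field_simp
  rw [hsum]
  filter_upwards [ae_all_iff.mpr hop,
    Lp.coeFn_smul ((((m.factorial : ℝ) / poch n m) ^ 2 : ℝ) : ℂ)
      (∑ l ∈ Finset.range (2 * m + 1), ((sigmaCoeff n m l / (l.factorial : ℝ) : ℝ) : ℂ) •
          ((((Real.pi / 2) ^ n * (1 / 2) ^ l * poch n l : ℝ) : ℂ) • F l) φ),
    Lp.coeFn_finsetSum (Finset.range (2 * m + 1)) fun l =>
      ((sigmaCoeff n m l / (l.factorial : ℝ) : ℝ) : ℂ) •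
          ((((Real.pi / 2) ^ n * (1 / 2) ^ l * poch n l : ℝ) : ℂ) • F l) φ,
    ae_all_iff.mpr fun l => Lp.coeFn_smul ((sigmaCoeff n m l / (l.factorial : ℝ) : ℝ) : ℂ)
      (((((Real.pi / 2) ^ n * (1 / 2) ^ l * poch n l : ℝ) : ℂ) • F l) φ)] with z h1 h2 h3 h4
  rw [phaseBerezin_eq n m hn, h2, Pi.smul_apply, h3, Finset.sum_apply, smul_eq_mul]
  congr 1
  refine Finset.sum_congr rfl fun l _ => ?_
  rw [h4, Pi.smul_apply, ← h1, smul_eq_mul]
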